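/- \textbf{Types.} $R,\ 1,\ A\otimes B,\ A\oplus B$ are positive, $A\multimapinv B$ (functions binding the leftmost variable) and $A\mathbin{\&}B$ are negative; central types are $W::=1\mid W\otimes W'\mid W\oplus W'$. Contexts are ordered lists of typed variables. \textbf{The calculus $\mathcal L$.} Expressions are generated by variables, $\mathbf{new}$, $\mathbf{delete}$, $(v,w)$, $()$, $\iota_iv$, $\lambda x.t$, $\langle t,u\rangle$, resources $r_n$ ($n\in\mathbb N$) and, annotated with the polarity $\varepsilon\in\{+,-\}$ of their type, $(\mathsf{let}\,x^{\pm}=t\,\mathsf{in}\,u)^\varepsilon$, $\delta(v,(x,y).t)^\varepsilon$, $\delta(v,().t)^\varepsilon$, $\delta(v,x.t,y.u)^\varepsilon$, $(v\,w)^\varepsilon$, $(\pi_iv)^\varepsilon$. Expressions of this last group are values iff they are annotated $-$ and their bodies are values; variables, constants, $()$, $r_n$, $\lambda x.t$, $\langle t,u\rangle$ are values, and $(v,w)$, $\iota_iv$ are values when $v,w$ are. $\mathcal L$ is typed by the usual rules of linear logic, with $\vdash\mathbf{new}:1\multimapinv(R\oplus1)$, $\vdash\mathbf{delete}:R\multimapinv1$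 (resources $r_n$ are not typable). Commands $\langle t\mid s\mid l\rangle^\varepsilon$ consist of an expression, a stack $s::=\star\mid v^\varepsilon\cdot s\mid\pi_i^\varepsilon\cdot s\mid(x^+.u)^\varepsilon\cdot s$, a freelist $l$ (a finite list of resources) and a polarity. They reduce by $\langle(\mathsf{let}\,x^-{=}v\,\mathsf{in}\,t)^\varepsilon|s|l\rangle^\varepsilon\rightsquigarrow\langle t[v/x]|s|l\rangle^\varepsilon$; $\langle(\mathsf{let}\,x^+{=}t\,\mathsf{in}\,u)^\varepsilon|s|l\rangle^\varepsilon\rightsquigarrow\langle t|(x^+.u)^\varepsilon\cdot s|l\rangle^+$; $\langle v|(x^+.t)^\varepsilon\cdot s|l\rangle^+\rightsquigarrow\langle t[v/x]|s|l\rangle^\varepsilon$ for a value $v$; $\langle(v\,w)^\varepsilon|s|l\rangle^\varepsilon\rightsquigarrow\langle v|w^\varepsilon\cdot s|l\rangle^-$; $\langle\lambda x.t|v^\varepsilon\cdot s|l\rangle^-\rightsquigarrow\langle t[v/x]|s|l\rangle^\varepsilon$; $\langle(\pi_iv)^\varepsilon|s|l\rangle^\varepsilon\rightsquigarrow\langle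 v|\pi_i^\varepsilon\cdot s|l\rangle^-$; $\langle\langle t_1,t_2\rangle|\pi_i^\varepsilon\cdot s|l\rangle^-\rightsquigarrow\langle t_i|s|l\rangle^\varepsilon$; the three $\delta$-expressions reduce to the selected branch when their argument is $(v,w)$, $()$, $\iota_iv$; $\langle\mathbf{new}|()\cdot s|r_n::l\rangle^-\rightsquigarrow\langle\iota_1r_n|s|l\rangle^+$; $\langle\mathbf{new}|()\cdot s|[\,]\rangle^-\rightsquigarrow\langle\iota_2()|s|[\,]\rangle^+$; $\langle\mathbf{delete}|r_n\cdot s|l\rangle^-\rightsquigarrow\langle()|s|r_n::l\rangle^+$. $\rightsquigarrow^*$ is the reflexive transitive closure. We write $t;u$ for $\mathsf{let}\,z=t\,\mathsf{in}\,\delta(z,().u)$. \textbf{The calculus $\mathcal O_{E,\mathbf{move}}$}, for a central type $E$ and a closed value $\mathsf{fail}$ of $\mathcal L$ with $\vdash\mathsf{fail}:E$. There are no structural rules (no exchange, weakening or contraction). Values: $x:A\vdash x:A$; $\vdash():1$; pairs $\Gamma,\Delta\vdash(v,w):A\otimes B$; injections; $\Gamma\vdash\lambda x.t:A\multimapinv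 B$ if $x:A,\Gamma\vdash t:B$; $\Gamma\vdash\langle t,u\rangle:A\mathbin\&B$; $\vdash\mathbf{drop}:A\multimapinv1$; $\vdash\mathbf{new}:1\multimapinv R$; $\vdash\mathbf{raise}:E\multimapinv A$; and every expression of negative type is a value and conversely. Expressions: $\mathsf{coerc}(v):P$ for a value $v$ of positive type $P$; $\Gamma,\Delta\vdash v\,w:B$ for $\Gamma\vdash w:A$, $\Delta\vdash v:A\multimapinv B$; $\pi_iv$; the eliminations $\Gamma,\Delta,\Gamma'\vdash\delta(v,\dots):C$ with $v$ typed in $\Delta$ and the bound variables standing in its place between $\Gamma$ and $\Gamma'$; $\Gamma,\Delta\vdash\mathsf{let}\,x=t\,\mathsf{in}\,u:B$ for $\Delta\vdash t:A$ and $\Gamma,x:A\vdash u:B$, with $t$ a value or $A$ positive; $\Gamma,\Delta\vdash\mathsf{try}\,x\Leftarrow t\,\mathsf{in}\,u\,\mathsf{unless}\,e\Rightarrow u':B$ for $\Delta\vdash t:P$ with $P$ positive, $\Gamma,x:P\vdash u:B$, $\Gamma,e:E\vdash u':B$; and $\Gamma,y:B,x:A,\Gamma'\vdash\mathbf{move}(x,y)\,\mathsf{in}\,t:C$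 for $\Gamma,x:A,y:B,\Gamma'\vdash t:C$. $\mathcal O_E$ is the fragment without $\mathbf{move}$. \textbf{Translation.} Let $A^+$ commute with $1,R,\otimes,\oplus$, and $N^+=N^-\mathbin\&1$ for negative $N$; $(A\multimapinv B)^-=A^+\multimapinv B^-$, $(A\mathbin\&B)^-=A^-\mathbin\&B^-$, $P^-=P^+\oplus E$ for positive $P$. Destructors: $\mathsf{drop}_1=\lambda v.v$, $\mathsf{drop}_R=\lambda r.\mathbf{delete}\,r$, $\mathsf{drop}_{A\otimes B}=\lambda p.\delta(p,(a,b).\mathsf{drop}_B\,b;\mathsf{drop}_A\,a)$, $\mathsf{drop}_{A\oplus B}=\lambda s.\delta(s,a.\mathsf{drop}_A\,a,b.\mathsf{drop}_B\,b)$, $\mathsf{drop}_N=\lambda a.\pi_2a$. Let $\mathsf{swap}_W:A\otimes W\multimapinv W\otimes A$ be the closed values $\mathsf{swap}_1=\lambda p.\delta(p,(a,i).\delta(i,().((),a)))$, $\mathsf{swap}_{W_1\oplus W_2}=\lambda p.\delta(p,(a,w).\delta(w,w_1.u_1,w_2.u_2))$ with $u_i=\mathsf{let}\,p_i=\mathsf{swap}_{W_i}(a,w_i)\,\mathsf{in}\,\delta(p_i,(w_i,a).(\iota_iw_i,a))$,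 and $\mathsf{swap}_{W_1\otimes W_2}=\lambda p.\delta(p,(a,w).\delta(w,(w_1,w_2).\mathsf{let}\,p_1=\mathsf{swap}_{W_2}((a,w_1),w_2)\,\mathsf{in}\,\delta(p_1,(w_2,p).\delta(p,(a,w_1).\mathsf{let}\,p_2=\mathsf{swap}_{W_1}((w_2,a),w_1)\,\mathsf{in}\,\delta(p_2,(w_1,p).\delta(p,(w_2,a).((w_1,w_2),a)))))))$. Put $\mathsf{dropctx}_\star=()$, $\mathsf{dropctx}_{\Gamma,x:A}=\mathsf{drop}_A\,x;\mathsf{dropctx}_\Gamma$; $\mathsf{unwind}_\star(e)=e$, $\mathsf{unwind}_{\Gamma,x:A}(e)=\mathsf{let}\,p=\mathsf{swap}_E(x,e)\,\mathsf{in}\,\delta(p,(e,x).\mathsf{drop}_A\,x;\mathsf{unwind}_\Gamma(e))$; $\mathsf{raise}^{B\multimapinv C}_\Gamma(e)=\lambda b.\mathsf{raise}^C_{b:B,\Gamma}(e)$, $\mathsf{raise}^{B\&C}_\Gamma(e)=\langle\mathsf{raise}^B_\Gamma(e),\mathsf{raise}^C_\Gamma(e)\rangle$, $\mathsf{raise}^P_\Gamma(e)=\mathsf{let}\,e'=\mathsf{unwind}_\Gamma(e)\,\mathsf{in}\,\iota_2e'$.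 On typing derivations, $\llbracket-\rrbracket$ (values $\Gamma\vdash A$ to values $\Gamma^+\vdash A^+$, expressions $\Gamma\vdash A$ to values $\Gamma^+\vdash A^-\mathbin\&1$) commutes with variables, $()$, pairs, injections, the three $\delta$'s and $\mathsf{let}$ of a value, is the identity on the passages between negative values and negative expressions, and $\llbracket\mathsf{coerc}(v)\rrbracket=\langle\iota_1\llbracket v\rrbracket,\mathsf{dropctx}_\Gamma\rangle$; $\llbracket\mathbf{drop}\rrbracket=\langle\lambda a.\mathsf{let}\,i=\mathsf{drop}_A\,a\,\mathsf{in}\,\iota_1i,()\rangle$; $\llbracket\mathbf{new}\rrbracket=\langle\lambda i.\delta(i,().\mathsf{let}\,x=\mathbf{new}\,()\,\mathsf{in}\,\delta(x,r.\iota_1r,j.\,j;\iota_2\mathsf{fail})),()\rangle$; $\llbracket\mathbf{raise}\rrbracket=\langle\lambda e.\mathsf{raise}^A_\star(e),()\rangle$; $\llbracket\mathbf{move}(x,y)\,\mathsf{in}\,t\rrbracket=\llbracket t\rrbracket$; for an expression $t:P$ with $P$ positive, $\llbracket\mathsf{let}\,x=t\,\mathsf{in}\,u\rrbracket=\mathsf{let}\,s=\pi_1\llbracket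 t\rrbracket\,\mathsf{in}\,\delta(s,x.\llbracket u\rrbracket,e.\langle\mathsf{raise}^B_\Gamma(e),\mathsf{dropctx}_{\Gamma,e:E}\rangle)$; $\llbracket\mathsf{try}\,x\Leftarrow t\,\mathsf{in}\,u\,\mathsf{unless}\,e\Rightarrow u'\rrbracket=\mathsf{let}\,s=\pi_1\llbracket t\rrbracket\,\mathsf{in}\,\delta(s,x.\llbracket u\rrbracket,e.\llbracket u'\rrbracket)$; $\llbracket\lambda x.t\rrbracket=\langle\lambda x.\pi_1\llbracket t\rrbracket,\mathsf{dropctx}_\Gamma\rangle$; $\llbracket v\,w\rrbracket=\langle(\pi_1\llbracket v\rrbracket)\llbracket w\rrbracket,\mathsf{dropctx}_{\Gamma,\Delta}\rangle$; $\llbracket\langle t,u\rangle\rrbracket=\langle\langle\pi_1\llbracket t\rrbracket,\pi_1\llbracket u\rrbracket\rangle,\mathsf{dropctx}_\Gamma\rangle$; $\llbracket\pi_iv\rrbracket=\langle\pi_i\pi_1\llbracket v\rrbracket,\mathsf{dropctx}_\Gamma\rangle$. \textbf{Theorem.} Let $E$ be a central type, $\vdash\mathsf{fail}:E$ a closed value,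 $W$ a central type, and $\vdash t:W$ a (derivation of a) closed expression of $\mathcal O_{E,\mathbf{move}}$. Then for every value $v$ of $\mathcal L$ and all freelists $l,l'$, \[\langle\pi_1\llbracket t\rrbracket\mid\star\mid l\rangle^+\rightsquigarrow^*\langle v\mid\star\mid l'\rangle^+\ \Longrightarrow\ l'\text{ is a permutation of }l.\] If moreover $t$ lies in $\mathcal O_E$ (its derivation does not use $\mathbf{move}$), then for every value $v$ and all freelists $l,l'$, \[\langle\pi_1\llbracket t\rrbracket\mid\star\mid l\rangle^+\rightsquigarrow^*\langle v\mid\star\mid l'\rangle^+\ \Longrightarrow\ l'=l.\] -/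

import Mathlib

namespace ResourceCalc

/-! ### Types and contexts (common to both calculi) -/

/-- Polarities. -/
inductive Pol
  | pos
  | neg

/-- Types: `R`, `1`, `A ⊗ B`, `A ⊕ B` (positive), and the left function type
`A ⊸ B` (binding the leftmost variable) and `A & B` (negative). -/
inductive Ty
  | res
  | one
  | tensor (A B : Ty)
  | plus (A B : Ty)
  | lolly (A B : Ty)
  | amp (A B : Ty)

/-- The polarity of a type. -/
def Ty.pol : Ty → Pol
  | .res => .pos
  | .one => .pos
  | .tensor _ _ => .pos
  | .plus _ _ => .pos
  | .lolly _ _ => .neg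
  | .amp _ _ => .neg

/-- Central types `W ::= 1 | W ⊗ W' | W ⊕ W'`. -/
inductive CentralTy
  | one
  | tensor (W W' : CentralTy)
  | plus (W W' : CentralTy)

/-- A central type, seen as a type. -/
def CentralTy.toTy : CentralTy → Ty
  | .one => .one
  | .tensor W W' => .tensor W.toTy W'.toTy
  | .plus W W' => .plus W.toTy W'.toTy

/-- Contexts: lists of typed variables, written from left to right. Variables are de Bruijn
indices; the order of the list is the order of the context and is independent of the order
in which the variables were bound. -/
abbrev Ctx := List (ℕ × Ty)

/-- The same context seen from under `k` additional binders. -/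
def Ctx.up (k : ℕ) (Γ : Ctx) : Ctx := Γ.map fun p => (p.1 + k, p.2)

/-! ### The calculus `L`: expressions, values, typing, abstract machine -/

/-- Expressions of `L`. A polarity `ε` in front of the arguments is the annotation `( ... )^ε`.
* `letin δ ε t u` is `(let x^δ = t in u)^ε`, with `x` index `0` in `u`;
* `casePair ε v t` is `δ(v, (x, y). t)^ε`, with `x` index `1` and `y` index `0` in `t`;
* `caseUnit ε v t` is `δ(v, (). t)^ε`;
* `caseSum ε v t u` is `δ(v, x. t, y. u)^ε`, with `x`, `y` index `0`;
* `app ε v w` is `(v w)^ε`, `fst ε v` is `(π₁ v)^ε`, `snd ε v` is `(π₂ v)^ε`;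
* `ampPair t u` is the lazy pair `⟨t, u⟩` and `res n` is the resource `r_n`. -/
inductive Tm
  | var (i : ℕ)
  | new
  | delete
  | pair (v w : Tm)
  | unit
  | inl (v : Tm)
  | inr (v : Tm)
  | lam (t : Tm)
  | ampPair (t u : Tm)
  | res (n : ℕ)
  | letin (δ ε : Pol) (t u : Tm)
  | casePair (ε : Pol) (v t : Tm)
  | caseUnit (ε : Pol) (v t : Tm)
  | caseSum (ε : Pol) (v t u : Tm)
  | app (ε : Pol) (v w : Tm)
  | fst (ε : Pol) (v : Tm)
  | snd (ε : Pol) (v : Tm)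

/-- Values: variables, constants, resources, positive introduction forms applied to values, lazy
introduction forms, and the expressions with negative annotation. -/
def Tm.IsVal : Tm → Prop
  | .var _ => True
  | .new => True
  | .delete => True
  | .pair v w => v.IsVal ∧ w.IsVal
  | .unit => True
  | .inl v => v.IsVal
  | .inr v => v.IsVal
  | .lam _ => True
  | .ampPair _ _ => True
  | .res _ => True
  | .letin _ ε _ u => ε = .neg ∧ u.IsVal
  | .casePair ε _ t => ε = .neg ∧ t.IsVal
  | .caseUnit ε _ t => ε = .neg ∧ t.IsVal
  | .caseSum ε _ t u => ε = .neg ∧ t.IsVal ∧ u.IsVal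
  | .app ε _ _ => ε = .neg
  | .fst ε _ => ε = .neg
  | .snd ε _ => ε = .neg

/-- A renaming, extended under one binder. -/
def liftRen (f : ℕ → ℕ) : ℕ → ℕ
  | 0 => 0
  | i + 1 => f i + 1

/-- Renaming of the free variables. -/
def Tm.rename (f : ℕ → ℕ) : Tm → Tm
  | .var i => .var (f i)
  | .new => .new
  | .delete => .delete
  | .pair v w => .pair (v.rename f) (w.rename f)
  | .unit => .unit
  | .inl v => .inl (v.rename f)
  | .inr v => .inr (v.rename f)
  | .lam t => .lam (t.rename (liftRen f))
  | .ampPair t u => .ampPair (t.rename f) (u.rename f)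
  | .res n => .res n
  | .letin δ ε t u => .letin δ ε (t.rename f) (u.rename (liftRen f))
  | .casePair ε v t => .casePair ε (v.rename f) (t.rename (liftRen (liftRen f)))
  | .caseUnit ε v t => .caseUnit ε (v.rename f) (t.rename f)
  | .caseSum ε v t u =>
      .caseSum ε (v.rename f) (t.rename (liftRen f)) (u.rename (liftRen f))
  | .app ε v w => .app ε (v.rename f) (w.rename f)
  | .fst ε v => .fst ε (v.rename f)
  | .snd ε v => .snd ε (v.rename f)

/-- The substitution with value `v` at index `0` and `σ i` at index `i + 1`. -/
def scons (v : Tm) (σ : ℕ → Tm) : ℕ → Tm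
  | 0 => v
  | i + 1 => σ i

/-- A substitution, extended under one binder. -/
def liftSub (σ : ℕ → Tm) : ℕ → Tm :=
  scons (.var 0) fun i => (σ i).rename Nat.succ

/-- Parallel capture-avoiding substitution. -/
def Tm.subst (σ : ℕ → Tm) : Tm → Tm
  | .var i => σ i
  | .new => .new
  | .delete => .delete
  | .pair v w => .pair (v.subst σ) (w.subst σ)
  | .unit => .unit
  | .inl v => .inl (v.subst σ)
  | .inr v => .inr (v.subst σ)
  | .lam t => .lam (t.subst (liftSub σ))
  | .ampPair t u => .ampPair (t.subst σ) (u.subst σ)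
  | .res n => .res n
  | .letin δ ε t u => .letin δ ε (t.subst σ) (u.subst (liftSub σ))
  | .casePair ε v t => .casePair ε (v.subst σ) (t.subst (liftSub (liftSub σ)))
  | .caseUnit ε v t => .caseUnit ε (v.subst σ) (t.subst σ)
  | .caseSum ε v t u => .caseSum ε (v.subst σ) (t.subst (liftSub σ)) (u.subst (liftSub σ))
  | .app ε v w => .app ε (v.subst σ) (w.subst σ)
  | .fst ε v => .fst ε (v.subst σ)
  | .snd ε v => .snd ε (v.subst σ)

/-- `t[v/x]` for the variable `x` of index `0`. -/
def Tm.inst (t v : Tm) : Tm := t.subst (scons v .var)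

/-- `t[v/x, w/y]` for the variables `x` of index `1` and `y` of index `0`. -/
def Tm.inst₂ (t v w : Tm) : Tm := t.subst (scons w (scons v .var))

/-- The typing judgement `Γ ⊢ t : A` of `L`. Since contexts name their variables, the structural
rule `struct` only has to permute them. -/
inductive Typed : Ctx → Tm → Ty → Prop
  | var (x : ℕ) (A : Ty) : Typed [(x, A)] (.var x) A
  | struct {Γ Γ' : Ctx} {t : Tm} {A : Ty} : Typed Γ t A → Γ.Perm Γ' → Typed Γ' t A
  | new : Typed [] .new (.lolly .one (.plus .res .one))
  | delete : Typed [] .delete (.lolly .res .one)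
  | letin {Γ Δ : Ctx} {t u : Tm} {A B : Ty} :
      Typed Δ t A → Typed (Γ.up 1 ++ [(0, A)]) u B →
      Typed (Γ ++ Δ) (.letin A.pol B.pol t u) B
  | pair {Γ Δ : Ctx} {v w : Tm} {A B : Ty} : v.IsVal → w.IsVal →
      Typed Γ v A → Typed Δ w B → Typed (Γ ++ Δ) (.pair v w) (.tensor A B)
  | casePair {Γ Δ Γ' : Ctx} {v t : Tm} {A B C : Ty} : v.IsVal →
      Typed Δ v (.tensor A B) → Typed (Γ.up 2 ++ [(1, A), (0, B)] ++ Γ'.up 2) t C →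
      Typed (Γ ++ Δ ++ Γ') (.casePair C.pol v t) C
  | unit : Typed [] .unit .one
  | caseUnit {Γ Δ Γ' : Ctx} {v t : Tm} {A : Ty} : v.IsVal →
      Typed Δ v .one → Typed (Γ ++ Γ') t A →
      Typed (Γ ++ Δ ++ Γ') (.caseUnit A.pol v t) A
  | inl {Γ : Ctx} {v : Tm} {A B : Ty} : v.IsVal → Typed Γ v A → Typed Γ (.inl v) (.plus A B)
  | inr {Γ : Ctx} {v : Tm} {A B : Ty} : v.IsVal → Typed Γ v B → Typed Γ (.inr v) (.plus A B)
  | caseSum {Γ Δ Γ' : Ctx} {v t u : Tm} {A B C : Ty} : v.IsVal →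
      Typed Δ v (.plus A B) → Typed (Γ.up 1 ++ [(0, A)] ++ Γ'.up 1) t C →
      Typed (Γ.up 1 ++ [(0, B)] ++ Γ'.up 1) u C →
      Typed (Γ ++ Δ ++ Γ') (.caseSum C.pol v t u) C
  | lam {Γ : Ctx} {t : Tm} {A B : Ty} :
      Typed ((0, A) :: Γ.up 1) t B → Typed Γ (.lam t) (.lolly A B)
  | app {Γ Δ : Ctx} {v w : Tm} {A B : Ty} : v.IsVal → w.IsVal →
      Typed Γ w A → Typed Δ v (.lolly A B) → Typed (Γ ++ Δ) (.app B.pol v w) B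
  | ampPair {Γ : Ctx} {t u : Tm} {A B : Ty} :
      Typed Γ t A → Typed Γ u B → Typed Γ (.ampPair t u) (.amp A B)
  | fst {Γ : Ctx} {v : Tm} {A B : Ty} : v.IsVal →
      Typed Γ v (.amp A B) → Typed Γ (.fst A.pol v) A
  | snd {Γ : Ctx} {v : Tm} {A B : Ty} : v.IsVal →
      Typed Γ v (.amp A B) → Typed Γ (.snd B.pol v) B

/-- Stacks `s ::= ⋆ | v^ε · s | π_i^ε · s | (x⁺. u)^ε · s`. -/
inductive Stack
  | nil
  | arg (ε : Pol) (v : Tm) (s : Stack)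
  | fst (ε : Pol) (s : Stack)
  | snd (ε : Pol) (s : Stack)
  | cont (ε : Pol) (u : Tm) (s : Stack)

/-- Commands `⟨t | s | l⟩^ε`; the list `l` is the freelist, a list of resource names. -/
structure Cmd where
  tm : Tm
  stack : Stack
  free : List ℕ
  pol : Pol

/-- The small-step reduction of commands. -/
inductive Step : Cmd → Cmd → Prop
  | letNeg (ε : Pol) (v t : Tm) (s : Stack) (l : List ℕ) :
      Step ⟨.letin .neg ε v t, s, l, ε⟩ ⟨t.inst v, s, l, ε⟩
  | letPos (ε : Pol) (t u : Tm) (s : Stack) (l : List ℕ) :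
      Step ⟨.letin .pos ε t u, s, l, ε⟩ ⟨t, .cont ε u s, l, .pos⟩
  | ret (ε : Pol) (v t : Tm) (s : Stack) (l : List ℕ) : v.IsVal →
      Step ⟨v, .cont ε t s, l, .pos⟩ ⟨t.inst v, s, l, ε⟩
  | app (ε : Pol) (v w : Tm) (s : Stack) (l : List ℕ) :
      Step ⟨.app ε v w, s, l, ε⟩ ⟨v, .arg ε w s, l, .neg⟩
  | lam (ε : Pol) (t v : Tm) (s : Stack) (l : List ℕ) :
      Step ⟨.lam t, .arg ε v s, l, .neg⟩ ⟨t.inst v, s, l, ε⟩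
  | fst (ε : Pol) (v : Tm) (s : Stack) (l : List ℕ) :
      Step ⟨.fst ε v, s, l, ε⟩ ⟨v, .fst ε s, l, .neg⟩
  | snd (ε : Pol) (v : Tm) (s : Stack) (l : List ℕ) :
      Step ⟨.snd ε v, s, l, ε⟩ ⟨v, .snd ε s, l, .neg⟩
  | ampFst (ε : Pol) (t u : Tm) (s : Stack) (l : List ℕ) :
      Step ⟨.ampPair t u, .fst ε s, l, .neg⟩ ⟨t, s, l, ε⟩
  | ampSnd (ε : Pol) (t u : Tm) (s : Stack) (l : List ℕ) :
      Step ⟨.ampPair t u, .snd ε s, l, .neg⟩ ⟨u, s, l, ε⟩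
  | casePair (ε : Pol) (v w t : Tm) (s : Stack) (l : List ℕ) :
      Step ⟨.casePair ε (.pair v w) t, s, l, ε⟩ ⟨t.inst₂ v w, s, l, ε⟩
  | caseUnit (ε : Pol) (t : Tm) (s : Stack) (l : List ℕ) :
      Step ⟨.caseUnit ε .unit t, s, l, ε⟩ ⟨t, s, l, ε⟩
  | caseInl (ε : Pol) (v t u : Tm) (s : Stack) (l : List ℕ) :
      Step ⟨.caseSum ε (.inl v) t u, s, l, ε⟩ ⟨t.inst v, s, l, ε⟩
  | caseInr (ε : Pol) (v t u : Tm) (s : Stack) (l : List ℕ) :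
      Step ⟨.caseSum ε (.inr v) t u, s, l, ε⟩ ⟨u.inst v, s, l, ε⟩
  | newSome (ε : Pol) (n : ℕ) (s : Stack) (l : List ℕ) :
      Step ⟨.new, .arg ε .unit s, n :: l, .neg⟩ ⟨.inl (.res n), s, l, .pos⟩
  | newNone (ε : Pol) (s : Stack) :
      Step ⟨.new, .arg ε .unit s, [], .neg⟩ ⟨.inr .unit, s, [], .pos⟩
  | delete (ε : Pol) (n : ℕ) (s : Stack) (l : List ℕ) :
      Step ⟨.delete, .arg ε (.res n) s, l, .neg⟩ ⟨.unit, s, n :: l, .pos⟩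

/-- Finitely many reduction steps. -/
abbrev Steps : Cmd → Cmd → Prop := Relation.ReflTransGen Step

/-! ### The calculus `O_{E,move}` -/

/-- The two kinds of judgements of `O_{E,move}`: values and expressions. -/
inductive Kind
  | val
  | exp

/-- Typing derivations of `O_{E,move}`, for the type `E` of exceptions. `Der E .val Γ A` are the
derivations of values `Γ ⊢ v : A` and `Der E .exp Γ A` those of expressions `Γ ⊢ t : A`.
Every negative expression is a value and conversely (`negVal`, `negExp`), positive values are
made into expressions by an explicit coercion (`coerc`). -/
inductive Der (E : CentralTy) : Kind → Ctx → Ty → Type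
  | var (x : ℕ) (A : Ty) : Der E .val [(x, A)] A
  | unit : Der E .val [] .one
  | pair {Γ Δ : Ctx} {A B : Ty} :
      Der E .val Γ A → Der E .val Δ B → Der E .val (Γ ++ Δ) (.tensor A B)
  | inl {Γ : Ctx} {A B : Ty} : Der E .val Γ A → Der E .val Γ (.plus A B)
  | inr {Γ : Ctx} {A B : Ty} : Der E .val Γ B → Der E .val Γ (.plus A B)
  | lam {Γ : Ctx} {A B : Ty} :
      Der E .exp ((0, A) :: Γ.up 1) B → Der E .val Γ (.lolly A B)
  | ampPair {Γ : Ctx} {A B : Ty} :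
      Der E .exp Γ A → Der E .exp Γ B → Der E .val Γ (.amp A B)
  | drop (A : Ty) : Der E .val [] (.lolly A .one)
  | new : Der E .val [] (.lolly .one .res)
  | raise (A : Ty) : Der E .val [] (.lolly E.toTy A)
  | negVal {Γ : Ctx} {A : Ty} : A.pol = .neg → Der E .exp Γ A → Der E .val Γ A
  | negExp {Γ : Ctx} {A : Ty} : A.pol = .neg → Der E .val Γ A → Der E .exp Γ A
  | coerc {Γ : Ctx} {A : Ty} : A.pol = .pos → Der E .val Γ A → Der E .exp Γ A
  /-- `move(x, y) in t` -/
  | move {Γ Γ' : Ctx} {x y : ℕ} {A B C : Ty} :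
      Der E .exp (Γ ++ [(x, A), (y, B)] ++ Γ') C →
      Der E .exp (Γ ++ [(y, B), (x, A)] ++ Γ') C
  /-- `let x = v in u` for a value `v` of any type -/
  | letVal {Γ Δ : Ctx} {A B : Ty} :
      Der E .val Δ A → Der E .exp (Γ.up 1 ++ [(0, A)]) B → Der E .exp (Γ ++ Δ) B
  /-- `let x = t in u` for an expression `t` of positive type -/
  | letExp {Γ Δ : Ctx} {A B : Ty} : A.pol = .pos →
      Der E .exp Δ A → Der E .exp (Γ.up 1 ++ [(0, A)]) B → Der E .exp (Γ ++ Δ) B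
  /-- `try x ⇐ t in u unless e ⇒ u'` -/
  | tryIn {Γ Δ : Ctx} {A B : Ty} : A.pol = .pos →
      Der E .exp Δ A → Der E .exp (Γ.up 1 ++ [(0, A)]) B →
      Der E .exp (Γ.up 1 ++ [(0, E.toTy)]) B → Der E .exp (Γ ++ Δ) B
  | casePair {Γ Δ Γ' : Ctx} {A B C : Ty} :
      Der E .val Δ (.tensor A B) → Der E .exp (Γ.up 2 ++ [(1, A), (0, B)] ++ Γ'.up 2) C →
      Der E .exp (Γ ++ Δ ++ Γ') C
  | caseUnit {Γ Δ Γ' : Ctx} {C : Ty} :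
      Der E .val Δ .one → Der E .exp (Γ ++ Γ') C → Der E .exp (Γ ++ Δ ++ Γ') C
  | caseSum {Γ Δ Γ' : Ctx} {A B C : Ty} :
      Der E .val Δ (.plus A B) → Der E .exp (Γ.up 1 ++ [(0, A)] ++ Γ'.up 1) C →
      Der E .exp (Γ.up 1 ++ [(0, B)] ++ Γ'.up 1) C → Der E .exp (Γ ++ Δ ++ Γ') C
  /-- `v w`, with the argument `w` on the left -/
  | app {Γ Δ : Ctx} {A B : Ty} :
      Der E .val Γ A → Der E .val Δ (.lolly A B) → Der E .exp (Γ ++ Δ) B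
  | fst {Γ : Ctx} {A B : Ty} : Der E .val Γ (.amp A B) → Der E .exp Γ A
  | snd {Γ : Ctx} {A B : Ty} : Der E .val Γ (.amp A B) → Der E .exp Γ B

/-- The derivation lies in the fragment `O_E`: it does not use `move`. -/
def Der.MoveFree {E : CentralTy} {k : Kind} {Γ : Ctx} {A : Ty} : Der E k Γ A → Prop
  | .var _ _ => True
  | .unit => True
  | .pair v w => v.MoveFree ∧ w.MoveFree
  | .inl v => v.MoveFree
  | .inr v => v.MoveFree
  | .lam t => t.MoveFree
  | .ampPair t u => t.MoveFree ∧ u.MoveFree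
  | .drop _ => True
  | .new => True
  | .raise _ => True
  | .negVal _ t => t.MoveFree
  | .negExp _ v => v.MoveFree
  | .coerc _ v => v.MoveFree
  | .move _ => False
  | .letVal v u => v.MoveFree ∧ u.MoveFree
  | .letExp _ t u => t.MoveFree ∧ u.MoveFree
  | .tryIn _ t u u' => t.MoveFree ∧ u.MoveFree ∧ u'.MoveFree
  | .casePair v t => v.MoveFree ∧ t.MoveFree
  | .caseUnit v t => v.MoveFree ∧ t.MoveFree
  | .caseSum v t u => v.MoveFree ∧ t.MoveFree ∧ u.MoveFree
  | .app w v => w.MoveFree ∧ v.MoveFree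
  | .fst v => v.MoveFree
  | .snd v => v.MoveFree

/-! ### The translation of `O_{E,move}` into `L` -/

/-- The pair `(A⁺, A⁻)` of interpretations of a type, where `⇑A = A ⊕ E` and `⇓A = A & 1`. -/
def Ty.interp (E : CentralTy) : Ty → Ty × Ty
  | .res => (.res, .plus .res E.toTy)
  | .one => (.one, .plus .one E.toTy)
  | .tensor A B =>
      (.tensor (A.interp E).1 (B.interp E).1,
        .plus (.tensor (A.interp E).1 (B.interp E).1) E.toTy)
  | .plus A B =>
      (.plus (A.interp E).1 (B.interp E).1,
        .plus (.plus (A.interp E).1 (B.interp E).1) E.toTy)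
  | .lolly A B =>
      (.amp (.lolly (A.interp E).1 (B.interp E).2) .one,
        .lolly (A.interp E).1 (B.interp E).2)
  | .amp A B =>
      (.amp (.amp (A.interp E).2 (B.interp E).2) .one,
        .amp (A.interp E).2 (B.interp E).2)

/-- The polarity of `A⁺`. -/
def Ty.polPos (E : CentralTy) (A : Ty) : Pol := (A.interp E).1.pol

/-- The polarity of `A⁻`. -/
def Ty.polNeg (E : CentralTy) (A : Ty) : Pol := (A.interp E).2.pol

/-- `t; u`, that is `let z = t in δ(z, (). u)`, for `u` of positive type. -/
def Tm.seq (t u : Tm) : Tm :=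
  .letin .pos .pos t (.caseUnit .pos (.var 0) (u.rename Nat.succ))

/-- The closed values `swap_W : A ⊗ W ⊸ W ⊗ A`; as untyped terms they do not depend on `A`. -/
def swap : CentralTy → Tm
  | .one =>
      -- `λp. δ(p, (a, i). δ(i, (). ((), a)))`
      .lam (.casePair .pos (.var 0)
        (.caseUnit .pos (.var 0) (.pair .unit (.var 1))))
  | .plus W₁ W₂ =>
      -- `λp. δ(p, (a, w). δ(w, w₁. let p₁ = swap (a, w₁) in δ(p₁, (w₁, a). (ι₁ w₁, a)), ...))`
      .lam (.casePair .pos (.var 0)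
        (.caseSum .pos (.var 0)
          (.letin .pos .pos (.app .pos (swap W₁) (.pair (.var 2) (.var 0)))
            (.casePair .pos (.var 0) (.pair (.inl (.var 1)) (.var 0))))
          (.letin .pos .pos (.app .pos (swap W₂) (.pair (.var 2) (.var 0)))
            (.casePair .pos (.var 0) (.pair (.inr (.var 1)) (.var 0))))))
  | .tensor W₁ W₂ =>
      -- `λp. δ(p, (a, w). δ(w, (w₁, w₂).`
      --   `let p₁ = swap ((a, w₁), w₂) in δ(p₁, (w₂, p). δ(p, (a, w₁).`
      --   `let p₂ = swap ((w₂, a), w₁) in δ(p₂, (w₁, p). δ(p, (w₂, a). ((w₁, w₂), a)))))))`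
      .lam (.casePair .pos (.var 0)
        (.casePair .pos (.var 0)
          (.letin .pos .pos
            (.app .pos (swap W₂) (.pair (.pair (.var 3) (.var 1)) (.var 0)))
            (.casePair .pos (.var 0)
              (.casePair .pos (.var 0)
                (.letin .pos .pos
                  (.app .pos (swap W₁) (.pair (.pair (.var 3) (.var 1)) (.var 0)))
                  (.casePair .pos (.var 0)
                    (.casePair .pos (.var 0)
                      (.pair (.pair (.var 3) (.var 1)) (.var 0))))))))))

/-- The destructors `drop_A : A⁺ ⊸ 1` (closed values). -/
def dropTy : Ty → Tm
  | .one => .lam (.var 0)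
  | .res => .lam (.app .pos .delete (.var 0))
  | .tensor A B =>
      .lam (.casePair .pos (.var 0)
        (.seq (.app .pos (dropTy B) (.var 0)) (.app .pos (dropTy A) (.var 1))))
  | .plus A B =>
      .lam (.caseSum .pos (.var 0) (.app .pos (dropTy A) (.var 0))
        (.app .pos (dropTy B) (.var 0)))
  | .lolly _ _ => .lam (.snd .pos (.var 0))
  | .amp _ _ => .lam (.snd .pos (.var 0))

/-- `dropCtx` on a context listed from right to left. -/
def dropCtxRev : Ctx → Tm
  | [] => .unit
  | (x, A) :: Γ => .seq (.app .pos (dropTy A) (.var x)) (dropCtxRev Γ)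

/-- `Γ⁺ ⊢ dropCtx_Γ : 1` drops each variable of the context, from right to left. -/
def dropCtx (Γ : Ctx) : Tm := dropCtxRev Γ.reverse

/-- `unwind` on a context listed from right to left and placed under `k` binders. -/
def unwindRev (E : CentralTy) : Ctx → ℕ → ℕ → Tm
  | [], _, e => .var e
  | (x, A) :: Γ, k, e =>
      -- `let p = swap_E (x, e) in δ(p, (e, x). drop_A x; unwind_Γ(e))`
      .letin .pos .pos (.app .pos (swap E) (.pair (.var (x + k)) (.var e)))
        (.casePair .pos (.var 0)
          (.seq (.app .pos (dropTy A) (.var 0)) (unwindRev E Γ (k + 3) 1)))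

/-- `Γ⁺, e : E ⊢ unwind_Γ(e) : E` drops the context and returns `e`. -/
def unwind (E : CentralTy) (Γ : Ctx) (e : ℕ) : Tm := unwindRev E Γ.reverse 0 e

/-- `Γ⁺, e : E ⊢ raise^A_Γ(e) : A⁻` drops the context and inhabits `A⁻` with `e`. -/
def raiseTm (E : CentralTy) : Ty → Ctx → ℕ → Tm
  | .lolly B C, Γ, e => .lam (raiseTm E C ((0, B) :: Γ.up 1) (e + 1))
  | .amp B C, Γ, e => .ampPair (raiseTm E B Γ e) (raiseTm E C Γ e)
  | .res, Γ, e => .letin .pos .pos (unwind E Γ e) (.inr (.var 0))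
  | .one, Γ, e => .letin .pos .pos (unwind E Γ e) (.inr (.var 0))
  | .tensor _ _, Γ, e => .letin .pos .pos (unwind E Γ e) (.inr (.var 0))
  | .plus _ _, Γ, e => .letin .pos .pos (unwind E Γ e) (.inr (.var 0))

/-- The translation `⟦-⟧` on derivations, for the exception `newFail : E` that is raised when an
allocation fails. A value `Γ ⊢ v : A` becomes a value `Γ⁺ ⊢ ⟦v⟧ : A⁺`, an expression
`Γ ⊢ t : A` becomes a value `Γ⁺ ⊢ ⟦t⟧ : ⇓A⁻`. -/
def tr {E : CentralTy} (newFail : Tm) {k : Kind} {Γ : Ctx} {A : Ty} : Der E k Γ A → Tm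
  | .var x _ => .var x
  | .unit => .unit
  | .pair v w => .pair (tr newFail v) (tr newFail w)
  | .inl v => .inl (tr newFail v)
  | .inr v => .inr (tr newFail v)
  | .lam (Γ := Γ) (B := B) t =>
      .ampPair (.lam (.fst (B.polNeg E) (tr newFail t))) (dropCtx Γ)
  | .ampPair (Γ := Γ) (A := A) (B := B) t u =>
      .ampPair (.ampPair (.fst (A.polNeg E) (tr newFail t)) (.fst (B.polNeg E) (tr newFail u)))
        (dropCtx Γ)
  | .drop A =>
      -- `⟨λa. let i = drop_A a in ι₁ i, ()⟩`
      .ampPair (.lam (.letin .pos .pos (.app .pos (dropTy A) (.var 0)) (.inl (.var 0)))) .unit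
  | .new =>
      -- `⟨λi. δ(i, (). let x = New () in δ(x, r. ι₁ r, i. i; ι₂ newFail)), ()⟩`
      .ampPair
        (.lam (.caseUnit .pos (.var 0)
          (.letin .pos .pos (.app .pos .new .unit)
            (.caseSum .pos (.var 0) (.inl (.var 0)) (.seq (.var 0) (.inr newFail))))))
        .unit
  | .raise A => .ampPair (.lam (raiseTm E A [] 0)) .unit
  | .negVal _ t => tr newFail t
  | .negExp _ v => tr newFail v
  | .coerc (Γ := Γ) _ v => .ampPair (.inl (tr newFail v)) (dropCtx Γ)
  | .move t => tr newFail t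
  | .letVal (A := A) v u => .letin (A.polPos E) .neg (tr newFail v) (tr newFail u)
  | .letExp (Γ := Γ) (B := B) _ t u =>
      -- `let s = π₁⟦t⟧ in δ(s, x. ⟦u⟧, e. ⟨raise^B_Γ(e), dropCtx_{Γ, e : E}⟩)`
      .letin .pos .neg (.fst .pos (tr newFail t))
        (.caseSum .neg (.var 0) ((tr newFail u).rename (liftRen Nat.succ))
          (.ampPair (raiseTm E B (Γ.up 2) 0) (dropCtx (Γ.up 2 ++ [(0, E.toTy)]))))
  | .tryIn _ t u u' =>
      -- `let s = π₁⟦t⟧ in δ(s, x. ⟦u⟧, e. ⟦u'⟧)`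
      .letin .pos .neg (.fst .pos (tr newFail t))
        (.caseSum .neg (.var 0) ((tr newFail u).rename (liftRen Nat.succ))
          ((tr newFail u').rename (liftRen Nat.succ)))
  | .casePair v t => .casePair .neg (tr newFail v) (tr newFail t)
  | .caseUnit v t => .caseUnit .neg (tr newFail v) (tr newFail t)
  | .caseSum v t u => .caseSum .neg (tr newFail v) (tr newFail t) (tr newFail u)
  | .app (Γ := Γ) (Δ := Δ) (B := B) w v =>
      .ampPair (.app (B.polNeg E) (.fst .neg (tr newFail v)) (tr newFail w)) (dropCtx (Γ ++ Δ))
  | .fst (Γ := Γ) (A := A) v =>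
      .ampPair (.fst (A.polNeg E) (.fst .neg (tr newFail v))) (dropCtx Γ)
  | .snd (Γ := Γ) (B := B) v =>
      .ampPair (.snd (B.polNeg E) (.fst .neg (tr newFail v))) (dropCtx Γ)

end ResourceCalc

namespace ResourceCalc

/-! ### Renaming and substitution -/

/-! Resources are conserved, and the proof measures this with a weight. A monoid `M` and a map `φ :
ℕ → M` are fixed. The weight of a freelist is the product of its entries, and a value of type `A⁺`
has as weight the product of the resources it holds, from left to right. The invariant is the
product (weight of the live context) * (weight of the freelist). The rightmost live resource
therefore stands next to the head of the freelist, which is exactly where `delete` pushes it and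
where `new` takes it from. A function receives its argument on the left of its own weight. What is
suspended on the stack lies further left, so every weight equation can be framed by left
multiplication.

The invariant is carried by a realizability model (`sem`), by recursion on types. Positive values
are described by their shape. A computation of positive type must return a value or an exception
with the weight preserved. A negative value is a lazy pair of a usable part and a part that releases
its whole weight. Values of central type hold no resource, so they have weight 1 (`val_toTy`). This
lets an exception move across a context in any monoid.

The fundamental lemma `interp_tr` shows that translated derivations lie in the model. All rules need
only associativity, except `move`, which exchanges two weights and needs commutativity. For a closed
term of central type, both the initial context and the result weigh 1, so the freelist weight is
unchanged. The model asserts that some run terminates, and determinism (`Steps.result_unique`)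
identifies this run with the given one.

The theorem follows by two choices of `M`: the free monoid on resource names, where the weight is
the freelist itself, and the free commutative monoid, where it is the freelist up to permutation. -/

theorem liftRen_comp (f g : ℕ → ℕ) : liftRen g ∘ liftRen f = liftRen (g ∘ f) := by
  funext i; cases i <;> rfl

/-- First of the four composition laws. Since `liftSub` renames, the binder case of a law involving
substitutions relies on the laws before it. -/
theorem Tm.rename_rename (t : Tm) : ∀ f g : ℕ → ℕ,
    (t.rename f).rename g = t.rename (g ∘ f) := by
  induction t <;> intro f g <;> simp_all [Tm.rename, liftRen_comp]

theorem liftSub_comp_liftRen (σ : ℕ → Tm) (f : ℕ → ℕ) :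
    liftSub σ ∘ liftRen f = liftSub (σ ∘ f) := by
  funext i; cases i <;> rfl

theorem Tm.subst_of_rename (t : Tm) : ∀ (f : ℕ → ℕ) (σ : ℕ → Tm),
    (t.rename f).subst σ = t.subst (σ ∘ f) := by
  induction t <;> intro f σ <;> simp_all [Tm.rename, Tm.subst, liftSub_comp_liftRen]

theorem rename_liftSub (σ : ℕ → Tm) (f : ℕ → ℕ) :
    (fun i => (liftSub σ i).rename (liftRen f)) = liftSub fun i => (σ i).rename f := by
  funext i
  cases i with
  | zero => rfl
  | succ i =>
    simp only [liftSub, scons, Tm.rename_rename]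
    rfl

theorem Tm.rename_of_subst (t : Tm) : ∀ (σ : ℕ → Tm) (f : ℕ → ℕ),
    (t.subst σ).rename f = t.subst fun i => (σ i).rename f := by
  induction t <;> intro σ f <;> simp_all [Tm.rename, Tm.subst, rename_liftSub]

theorem subst_liftSub (σ τ : ℕ → Tm) :
    (fun i => (liftSub σ i).subst (liftSub τ)) = liftSub fun i => (σ i).subst τ := by
  funext i
  cases i with
  | zero => rfl
  | succ i =>
    simp only [liftSub, scons, Tm.subst_of_rename, Tm.rename_of_subst]
    rfl

theorem Tm.subst_subst (t : Tm) : ∀ σ τ : ℕ → Tm,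
    (t.subst σ).subst τ = t.subst fun i => (σ i).subst τ := by
  induction t <;> intro σ τ <;> simp_all [Tm.subst, subst_liftSub]

theorem liftSub_var : liftSub Tm.var = Tm.var := by
  funext i; cases i <;> rfl

theorem Tm.subst_var (t : Tm) : t.subst .var = t := by
  induction t <;> simp_all [Tm.subst, liftSub_var]

theorem Tm.rename_succ_subst_scons (t v : Tm) (σ : ℕ → Tm) :
    (t.rename Nat.succ).subst (scons v σ) = t.subst σ :=
  t.subst_of_rename _ _

/-- Turns the substitution made by a machine step into an extension of the environment, so that open
terms can be run under an environment without ever composing substitutions by hand. -/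
theorem Tm.inst_liftSub (t v : Tm) (σ : ℕ → Tm) :
    (t.subst (liftSub σ)).inst v = t.subst (scons v σ) := by
  rw [Tm.inst, Tm.subst_subst]
  congr 1
  funext i
  cases i with
  | zero => rfl
  | succ i => exact (Tm.rename_succ_subst_scons _ _ _).trans (Tm.subst_var _)

theorem Tm.inst₂_liftSub (t v w : Tm) (σ : ℕ → Tm) :
    (t.subst (liftSub (liftSub σ))).inst₂ v w = t.subst (scons w (scons v σ)) := by
  rw [Tm.inst₂, Tm.subst_subst]
  congr 1
  funext i
  match i with
  | 0 => rfl
  | 1 => rfl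
  | i + 2 =>
    exact (Tm.rename_succ_subst_scons _ _ _).trans
      ((Tm.rename_succ_subst_scons _ _ _).trans (Tm.subst_var _))

theorem Tm.IsVal.rename {t : Tm} (h : t.IsVal) (f : ℕ → ℕ) : (t.rename f).IsVal := by
  induction t generalizing f <;> simp_all [Tm.IsVal, Tm.rename]

theorem liftSub_isVal {σ : ℕ → Tm} (h : ∀ i, (σ i).IsVal) (i : ℕ) : (liftSub σ i).IsVal := by
  cases i with
  | zero => trivial
  | succ i => exact (h i).rename _

theorem scons_isVal {v : Tm} {σ : ℕ → Tm} (hv : v.IsVal) (h : ∀ i, (σ i).IsVal) (i : ℕ) :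
    (scons v σ i).IsVal := by
  cases i with
  | zero => exact hv
  | succ i => exact h i

theorem Tm.IsVal.subst {t : Tm} (ht : t.IsVal) {σ : ℕ → Tm} (h : ∀ i, (σ i).IsVal) :
    (t.subst σ).IsVal := by
  induction t generalizing σ with
  | casePair ε v t _ ih =>
    exact ⟨ht.1, ih ht.2 (liftSub_isVal (liftSub_isVal h))⟩
  | _ => simp_all [Tm.IsVal, Tm.subst, liftSub_isVal]

theorem Tm.seq_subst (t u : Tm) (σ : ℕ → Tm) :
    (t.seq u).subst σ = (t.subst σ).seq (u.subst σ) := by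
  simp only [Tm.seq, Tm.subst, Tm.subst_of_rename, Tm.rename_of_subst]
  rfl

@[simp]
theorem swap_subst (W : CentralTy) (σ : ℕ → Tm) : (swap W).subst σ = swap W := by
  induction W generalizing σ <;> simp_all [swap, Tm.subst, liftSub, scons, Tm.rename]

@[simp]
theorem dropTy_subst (A : Ty) (σ : ℕ → Tm) : (dropTy A).subst σ = dropTy A := by
  induction A generalizing σ <;>
    simp_all [dropTy, Tm.subst, liftSub, scons, Tm.rename, Tm.seq_subst]

/-- The substitution `σ` fixes the variables of `Γ`. -/
def Fixes (σ : ℕ → Tm) (Γ : Ctx) : Prop := ∀ p ∈ Γ, σ p.1 = .var p.1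

theorem fixes_append {σ : ℕ → Tm} {Γ Δ : Ctx} :
    Fixes σ (Γ ++ Δ) ↔ Fixes σ Γ ∧ Fixes σ Δ := by
  simp only [Fixes, List.mem_append, or_imp, forall_and]

theorem fixes_cons {σ : ℕ → Tm} {p : ℕ × Ty} {Γ : Ctx} :
    Fixes σ (p :: Γ) ↔ σ p.1 = .var p.1 ∧ Fixes σ Γ := by
  simp only [Fixes, List.mem_cons, or_imp, forall_and, forall_eq]

theorem fixes_nil {σ : ℕ → Tm} : Fixes σ [] := fun _ h => nomatch h

theorem Fixes.up {σ : ℕ → Tm} {Γ : Ctx} (h : Fixes σ Γ) : Fixes (liftSub σ) (Γ.up 1) := by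
  intro p hp
  obtain ⟨q, hq, rfl⟩ := List.mem_map.1 hp
  simp [liftSub, scons, h q hq, Tm.rename]

theorem Ctx.up_up (Γ : Ctx) (j k : ℕ) : (Γ.up j).up k = Γ.up (j + k) := by
  simp [Ctx.up, add_assoc]

theorem Fixes.up_two {σ : ℕ → Tm} {Γ : Ctx} (h : Fixes σ Γ) :
    Fixes (liftSub (liftSub σ)) (Γ.up 2) := by
  simpa only [Ctx.up_up] using h.up.up

/-- Needed for the empty context: the exception `newFail` is then closed, so the environments under
which the translation of `new` is run leave it unchanged. -/
theorem Typed.subst_eq {Γ : Ctx} {t : Tm} {A : Ty} (h : Typed Γ t A) :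
    ∀ σ : ℕ → Tm, Fixes σ Γ → t.subst σ = t := by
  have h0 : ∀ σ : ℕ → Tm, liftSub σ 0 = .var 0 := fun _ => rfl
  have h1 : ∀ σ : ℕ → Tm, liftSub (liftSub σ) 1 = .var 1 := fun _ => rfl
  induction h with
  | struct _ hp ih => exact fun σ hσ => ih σ fun p hm => hσ p (hp.subset hm)
  | _ =>
    intro σ hσ
    simp_all only [Tm.subst, fixes_append, fixes_cons, fixes_nil, Fixes.up, Fixes.up_two,
      and_self, and_true]

/-! ### Determinism of the machine -/

/-- The only threatening overlap is `ret` with an elimination rule. Polarities exclude it: `ret`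
fires in a positive command, whereas an elimination that is a value carries a negative annotation,
which is also the polarity of the command it reduces in. -/
theorem Step.deterministic {c c₁ c₂ : Cmd} (h₁ : Step c c₁) (h₂ : Step c c₂) : c₁ = c₂ := by
  cases h₁ <;> cases h₂ <;> simp_all [Tm.IsVal]

theorem not_step_of_isVal {v : Tm} {l : List ℕ} {c : Cmd} (hv : v.IsVal) :
    ¬ Step ⟨v, .nil, l, .pos⟩ c := by
  intro h
  cases h <;> simp_all [Tm.IsVal]

theorem Steps.result_unique {c : Cmd} {v w : Tm} {l l' : List ℕ} (hv : v.IsVal) (hw : w.IsVal)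
    (h₁ : Steps c ⟨v, .nil, l, .pos⟩) (h₂ : Steps c ⟨w, .nil, l', .pos⟩) : v = w ∧ l = l' := by
  induction h₁ using Relation.ReflTransGen.head_induction_on with
  | refl =>
    rcases h₂.cases_head with h | ⟨d, hd, _⟩
    · cases h; exact ⟨rfl, rfl⟩
    · exact (not_step_of_isVal hv hd).elim
  | head hs _ ih =>
    rcases h₂.cases_head with h | ⟨d, hd, h⟩
    · subst h; exact (not_step_of_isVal hw hs).elim
    · rw [hs.deterministic hd] at ih; exact ih h

/-! ### Reductions of substituted terms -/

/-- Machine rules for a term under an environment. In the `case` rules below, the scrutinee only has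
to take constructor form after substitution. -/
theorem Step.letPos_subst (ε : Pol) (t u : Tm) (σ : ℕ → Tm) (s : Stack) (l : List ℕ) :
    Step ⟨(Tm.letin .pos ε t u).subst σ, s, l, ε⟩
      ⟨t.subst σ, .cont ε (u.subst (liftSub σ)) s, l, .pos⟩ :=
  .letPos _ _ _ _ _

theorem Step.letNeg_subst (ε : Pol) (t u : Tm) (σ : ℕ → Tm) (s : Stack) (l : List ℕ) :
    Step ⟨(Tm.letin .neg ε t u).subst σ, s, l, ε⟩ ⟨u.subst (scons (t.subst σ) σ), s, l, ε⟩ := by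
  rw [← Tm.inst_liftSub]
  exact .letNeg _ _ _ _ _

theorem Step.ret_subst (ε : Pol) {v : Tm} (hv : v.IsVal) (u : Tm) (σ : ℕ → Tm) (s : Stack)
    (l : List ℕ) :
    Step ⟨v, .cont ε (u.subst (liftSub σ)) s, l, .pos⟩ ⟨u.subst (scons v σ), s, l, ε⟩ := by
  rw [← Tm.inst_liftSub]
  exact .ret _ _ _ _ _ hv

theorem Step.lam_subst (ε : Pol) (t v : Tm) (σ : ℕ → Tm) (s : Stack) (l : List ℕ) :
    Step ⟨(Tm.lam t).subst σ, .arg ε v s, l, .neg⟩ ⟨t.subst (scons v σ), s, l, ε⟩ := by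
  rw [← Tm.inst_liftSub]
  exact .lam _ _ _ _ _

theorem Step.casePair_subst {ε : Pol} {u v w : Tm} (t : Tm) {σ : ℕ → Tm} (s : Stack)
    (l : List ℕ) (h : u.subst σ = .pair v w) :
    Step ⟨(Tm.casePair ε u t).subst σ, s, l, ε⟩ ⟨t.subst (scons w (scons v σ)), s, l, ε⟩ := by
  rw [← Tm.inst₂_liftSub, Tm.subst, h]
  exact .casePair _ _ _ _ _ _

theorem Step.caseUnit_subst {ε : Pol} {u : Tm} (t : Tm) {σ : ℕ → Tm} (s : Stack)
    (l : List ℕ) (h : u.subst σ = .unit) :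
    Step ⟨(Tm.caseUnit ε u t).subst σ, s, l, ε⟩ ⟨t.subst σ, s, l, ε⟩ := by
  rw [Tm.subst, h]
  exact .caseUnit _ _ _ _

theorem Step.caseInl_subst {ε : Pol} {u v : Tm} (t₁ t₂ : Tm) {σ : ℕ → Tm} (s : Stack)
    (l : List ℕ) (h : u.subst σ = .inl v) :
    Step ⟨(Tm.caseSum ε u t₁ t₂).subst σ, s, l, ε⟩ ⟨t₁.subst (scons v σ), s, l, ε⟩ := by
  rw [← Tm.inst_liftSub, Tm.subst, h]
  exact .caseInl _ _ _ _ _ _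

theorem Step.caseInr_subst {ε : Pol} {u v : Tm} (t₁ t₂ : Tm) {σ : ℕ → Tm} (s : Stack)
    (l : List ℕ) (h : u.subst σ = .inr v) :
    Step ⟨(Tm.caseSum ε u t₁ t₂).subst σ, s, l, ε⟩ ⟨t₂.subst (scons v σ), s, l, ε⟩ := by
  rw [← Tm.inst_liftSub, Tm.subst, h]
  exact .caseInr _ _ _ _ _ _

theorem Steps.app_lam (ε : Pol) (t v : Tm) (s : Stack) (l : List ℕ) :
    Steps ⟨.app ε (.lam t) v, s, l, ε⟩ ⟨t.subst (scons v .var), s, l, ε⟩ :=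
  .head (.app _ _ _ _ _) (.single (.lam _ _ _ _ _))

theorem Steps.ret_caseUnit (u : Tm) (s : Stack) (l : List ℕ) :
    Steps ⟨.unit, .cont .pos (.caseUnit .pos (.var 0) (u.rename Nat.succ)) s, l, .pos⟩
      ⟨u, s, l, .pos⟩ := by
  have := Step.caseUnit_subst (ε := .pos) (u := .var 0) (u.rename Nat.succ)
    (σ := scons .unit .var) s l rfl
  rw [Tm.rename_succ_subst_scons, Tm.subst_var] at this
  exact .head (.ret _ _ _ _ _ trivial) (.single this)

theorem Tm.IsVal.pair {v w : Tm} (hv : v.IsVal) (hw : w.IsVal) : (Tm.pair v w).IsVal :=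
  ⟨hv, hw⟩

/-! ### Values of central type and their swapping -/

/-- The closed values of a central type. -/
def CentralVal : CentralTy → Tm → Prop
  | .one, v => v = .unit
  | .tensor W W', v => ∃ a b, v = .pair a b ∧ CentralVal W a ∧ CentralVal W' b
  | .plus W W', v => (∃ a, v = .inl a ∧ CentralVal W a) ∨ ∃ a, v = .inr a ∧ CentralVal W' a

theorem CentralVal.isVal {W : CentralTy} {v : Tm} (h : CentralVal W v) : v.IsVal := by
  induction W generalizing v with
  | one => rw [h]; trivial
  | tensor _ _ ih₁ ih₂ =>
    obtain ⟨a, b, rfl, ha, hb⟩ := h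
    exact ⟨ih₁ ha, ih₂ hb⟩
  | plus _ _ ih₁ ih₂ =>
    rcases h with ⟨a, rfl, ha⟩ | ⟨a, rfl, ha⟩
    · exact (ih₁ ha :)
    · exact (ih₂ ha :)

theorem Typed.centralVal {Γ : Ctx} {v : Tm} {A : Ty} (h : Typed Γ v A) (hv : v.IsVal)
    (hΓ : Γ = []) (W : CentralTy) (hA : A = W.toTy) : CentralVal W v := by
  -- Central types are positive, so an elimination typed at one is annotated positively and is not a
  -- value. This disposes of the last case of the induction.
  have hpol (W : CentralTy) : W.toTy.pol = .pos := by cases W <;> rfl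
  induction h generalizing W with
  | struct _ hp ih => exact ih hv (hΓ ▸ hp).eq_nil W hA
  | var => cases hΓ
  | pair _ _ _ _ ih₁ ih₂ =>
    obtain ⟨h₁, h₂⟩ := List.append_eq_nil_iff.1 hΓ
    cases W <;> cases hA
    exact ⟨_, _, rfl, ih₁ hv.1 h₁ _ rfl, ih₂ hv.2 h₂ _ rfl⟩
  | unit => cases W <;> cases hA; rfl
  | inl _ _ ih => cases W <;> cases hA; exact .inl ⟨_, rfl, ih hv hΓ _ rfl⟩
  | inr _ _ ih => cases W <;> cases hA; exact .inr ⟨_, rfl, ih hv hΓ _ rfl⟩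
  | new | delete | lam | ampPair => cases W <;> cases hA
  | _ => simp_all [Tm.IsVal]

/-- The central value is taken apart and rebuilt on the other side by pattern matching alone, so the
freelist is not touched. -/
theorem swap_steps (W : CentralTy) : ∀ (v w : Tm), v.IsVal → CentralVal W w →
    ∀ (s : Stack) (l : List ℕ),
    Steps ⟨.app .pos (swap W) (.pair v w), s, l, .pos⟩ ⟨.pair w v, s, l, .pos⟩ := by
  induction W with
  | one =>
    rintro v _ hv rfl s l
    refine (Steps.app_lam _ _ _ _ _).trans (.head (.casePair_subst _ _ _ rfl) ?_)
    exact .single (.caseUnit_subst _ _ _ rfl)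
  | plus W₁ W₂ ih₁ ih₂ =>
    intro v w hv hw s l
    refine (Steps.app_lam _ _ _ _ _).trans (.head (.casePair_subst _ _ _ rfl) ?_)
    rcases hw with ⟨a, rfl, ha⟩ | ⟨a, rfl, ha⟩
    · refine .head (.caseInl_subst _ _ _ _ rfl) (.head (.letPos_subst _ _ _ _ _ _) ?_)
      -- `Tm.subst.eq_15` is the equation for `app`. Only this node is unfolded, to expose the
      -- closed term `swap W₁`; the rest stays in environment form.
      simp only [Tm.subst.eq_15, swap_subst]
      refine (ih₁ v a hv ha _ _).trans (.head (.ret_subst _ (ha.isVal.pair hv) _ _ _ _) ?_)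
      exact .single (.casePair_subst _ _ _ rfl)
    · refine .head (.caseInr_subst _ _ _ _ rfl) (.head (.letPos_subst _ _ _ _ _ _) ?_)
      simp only [Tm.subst.eq_15, swap_subst]
      refine (ih₂ v a hv ha _ _).trans (.head (.ret_subst _ (ha.isVal.pair hv) _ _ _ _) ?_)
      exact .single (.casePair_subst _ _ _ rfl)
  | tensor W₁ W₂ ih₁ ih₂ =>
    rintro v _ hv ⟨a, b, rfl, ha, hb⟩ s l
    refine (Steps.app_lam _ _ _ _ _).trans (.head (.casePair_subst _ _ _ rfl) ?_)
    refine .head (.casePair_subst _ _ _ rfl) (.head (.letPos_subst _ _ _ _ _ _) ?_)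
    simp only [Tm.subst.eq_15, swap_subst]
    refine (ih₂ (.pair v a) b ⟨hv, ha.isVal⟩ hb _ _).trans
      (.head (.ret_subst _ (hb.isVal.pair (hv.pair ha.isVal)) _ _ _ _) ?_)
    refine .head (.casePair_subst _ _ _ rfl) (.head (.casePair_subst _ _ _ rfl) ?_)
    refine .head (.letPos_subst _ _ _ _ _ _) ?_
    simp only [Tm.subst.eq_15, swap_subst]
    refine (ih₁ (.pair b v) a ⟨hb.isVal, hv⟩ ha _ _).trans
      (.head (.ret_subst _ (ha.isVal.pair (hb.isVal.pair hv)) _ _ _ _) ?_)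
    exact .head (.casePair_subst _ _ _ rfl) (.single (.casePair_subst _ _ _ rfl))

/-! ### The weighted logical relation

Resources are weighed in a monoid `M`. In a command the weight of the live resources, in the
order of the context, times that of the freelist is invariant. -/

section Semantics

variable {M : Type*} [Monoid M] (φ : ℕ → M)

/-- The weight of a list of resources. -/
def weight (l : List ℕ) : M := (l.map φ).prod

theorem weight_cons (n : ℕ) (l : List ℕ) : weight φ (n :: l) = φ n * weight φ l := by
  simp [weight]

/-- The term `t` evaluates to `()` and releases resources of weight `ρ`. -/
def DropsTo (t : Tm) (ρ : M) : Prop :=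
  ∀ (s : Stack) (l : List ℕ), ∃ l',
    Steps ⟨t, s, l, .pos⟩ ⟨.unit, s, l', .pos⟩ ∧ weight φ l' = ρ * weight φ l

/-- The command with a hole `c` returns either a value in `V` or an exception. -/
def Returns (E : CentralTy) (V : M → Tm → Prop) (ρ : M) (c : Stack → List ℕ → Cmd) : Prop :=
  ∀ (s : Stack) (l : List ℕ), ∃ v l',
    (Steps (c s l) ⟨.inl v, s, l', .pos⟩ ∧
      ∃ ρ', V ρ' v ∧ ρ' * weight φ l' = ρ * weight φ l) ∨
    (Steps (c s l) ⟨.inr v, s, l', .pos⟩ ∧ CentralVal E v ∧ weight φ l' = ρ * weight φ l)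

/-- The lazy pair `v` has a first component in `G`, and its second component releases `ρ`. -/
def LazyPair (G : M → (Stack → List ℕ → Cmd) → Prop) (ε : Pol) (ρ : M) (v : Tm) : Prop :=
  G ρ (fun s l => ⟨v, .fst ε s, l, .neg⟩) ∧ DropsTo φ (.snd .pos v) ρ

/-- The values of type `A⁺` and the computations of type `A⁻`, with the weights of their
resources. -/
def sem (E : CentralTy) : Ty → (M → Tm → Prop) × (M → (Stack → List ℕ → Cmd) → Prop)
  | .res =>
      let V := fun ρ v => ∃ n, v = .res n ∧ ρ = φ n
      (V, Returns φ E V)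
  | .one =>
      let V := fun ρ v => v = .unit ∧ ρ = 1
      (V, Returns φ E V)
  | .tensor A B =>
      let V := fun ρ v => ∃ ρ₁ ρ₂ a b, (sem E A).1 ρ₁ a ∧ (sem E B).1 ρ₂ b ∧
        v = .pair a b ∧ ρ = ρ₁ * ρ₂
      (V, Returns φ E V)
  | .plus A B =>
      let V := fun ρ v => (∃ a, v = .inl a ∧ (sem E A).1 ρ a) ∨ ∃ a, v = .inr a ∧ (sem E B).1 ρ a
      (V, Returns φ E V)
  | .lolly A B =>
      let G := fun ρ c => ∀ ρ' v, (sem E A).1 ρ' v →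
        (sem E B).2 (ρ' * ρ) fun s l => c (.arg (B.polNeg E) v s) l
      (fun ρ v => v.IsVal ∧ LazyPair φ G .neg ρ v, G)
  | .amp A B =>
      let G := fun ρ c => ((sem E A).2 ρ fun s l => c (.fst (A.polNeg E) s) l) ∧
        (sem E B).2 ρ fun s l => c (.snd (B.polNeg E) s) l
      (fun ρ v => v.IsVal ∧ LazyPair φ G .neg ρ v, G)

/-- The values of type `A⁺`. -/
def Val (E : CentralTy) (A : Ty) : M → Tm → Prop := (sem φ E A).1

/-- The computations of type `A⁻`. -/
def Comp (E : CentralTy) (A : Ty) : M → (Stack → List ℕ → Cmd) → Prop := (sem φ E A).2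

/-- The values of type `A⁻ & 1` that interpret expressions. -/
def Expr (E : CentralTy) (A : Ty) : M → Tm → Prop := LazyPair φ (Comp φ E A) (A.polNeg E)

/-- The substitution `γ` interprets the context `Γ` with resources of weight `ρ`. -/
def Env (E : CentralTy) : Ctx → M → (ℕ → Tm) → Prop
  | [], ρ, _ => ρ = 1
  | (x, A) :: Γ, ρ, γ => ∃ ρ₁ ρ₂, Val φ E A ρ₁ (γ x) ∧ Env E Γ ρ₂ γ ∧ ρ = ρ₁ * ρ₂

/-! ### Values and computations according to polarity -/

variable {φ} {E : CentralTy} {A B : Ty} {ρ : M}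

theorem comp_of_pos (h : A.pol = .pos) : Comp φ E A = Returns φ E (Val φ E A) := by
  cases A <;> first | rfl | cases h

theorem polNeg_eq (E : CentralTy) (A : Ty) : A.polNeg E = A.pol := by
  cases A <;> rfl

theorem polPos_eq (E : CentralTy) (A : Ty) : A.polPos E = A.pol := by
  cases A <;> rfl

/-- At negative types `A⁺` is `A⁻ & 1`, so values and expressions share one interpretation. This is
why the two passages between them can be translated by the identity. -/
theorem val_of_neg (h : A.pol = .neg) {v : Tm} :
    Val φ E A ρ v ↔ v.IsVal ∧ Expr φ E A ρ v := by
  cases A <;> first | rfl | cases h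

theorem Val.isVal {v : Tm} (h : Val φ E A ρ v) : v.IsVal := by
  induction A generalizing ρ v with
  | res => obtain ⟨n, rfl, -⟩ := h; trivial
  | one => obtain ⟨rfl, -⟩ := h; trivial
  | tensor _ _ ih₁ ih₂ =>
    obtain ⟨_, _, a, b, ha, hb, rfl, -⟩ := h
    exact ⟨ih₁ ha, ih₂ hb⟩
  | plus _ _ ih₁ ih₂ =>
    rcases h with ⟨a, rfl, ha⟩ | ⟨a, rfl, ha⟩
    · exact (ih₁ ha :)
    · exact (ih₂ ha :)
  | lolly => exact h.1
  | amp => exact h.1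

/-- No resource occurs in a central type. Weight 1 makes exceptions commute with any context, and
makes the final result disappear from the invariant. -/
theorem val_toTy {W : CentralTy} {v : Tm} : Val φ E W.toTy ρ v ↔ CentralVal W v ∧ ρ = 1 := by
  induction W generalizing ρ v with
  | one => rfl
  | tensor W₁ W₂ ih₁ ih₂ =>
    constructor
    · rintro ⟨_, _, a, b, ha, hb, rfl, rfl⟩
      obtain ⟨ha', rfl⟩ := ih₁.1 ha
      obtain ⟨hb', rfl⟩ := ih₂.1 hb
      exact ⟨⟨a, b, rfl, ha', hb'⟩, mul_one 1⟩
    · rintro ⟨⟨a, b, rfl, ha, hb⟩, rfl⟩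
      exact ⟨1, 1, a, b, ih₁.2 ⟨ha, rfl⟩, ih₂.2 ⟨hb, rfl⟩, rfl, (mul_one 1).symm⟩
  | plus W₁ W₂ ih₁ ih₂ =>
    constructor
    · rintro (⟨a, rfl, ha⟩ | ⟨a, rfl, ha⟩)
      · exact ⟨.inl ⟨a, rfl, (ih₁.1 ha).1⟩, (ih₁.1 ha).2⟩
      · exact ⟨.inr ⟨a, rfl, (ih₂.1 ha).1⟩, (ih₂.1 ha).2⟩
    · rintro ⟨⟨a, rfl, ha⟩ | ⟨a, rfl, ha⟩, rfl⟩
      · exact .inl ⟨a, rfl, ih₁.2 ⟨ha, rfl⟩⟩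
      · exact .inr ⟨a, rfl, ih₂.2 ⟨ha, rfl⟩⟩

/-! #### Closure under expansion -/

theorem DropsTo.of_steps {t : Tm} (h : ∀ s l, ∃ l' ρ' t',
    Steps ⟨t, s, l, .pos⟩ ⟨t', s, l', .pos⟩ ∧ ρ' * weight φ l' = ρ * weight φ l ∧
      DropsTo φ t' ρ') : DropsTo φ t ρ := by
  intro s l
  obtain ⟨l', ρ', t', h₁, hw, h₂⟩ := h s l
  obtain ⟨l'', h₂, hw'⟩ := h₂ s l'
  exact ⟨l'', h₁.trans h₂, hw'.trans hw⟩

theorem Returns.of_steps {V : M → Tm → Prop} {c : Stack → List ℕ → Cmd}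
    (h : ∀ s l, ∃ l' ρ' c', Steps (c s l) (c' s l') ∧ ρ' * weight φ l' = ρ * weight φ l ∧
      Returns φ E V ρ' c') : Returns φ E V ρ c := by
  intro s l
  obtain ⟨l', ρ', c', h₁, hw, h₂⟩ := h s l
  obtain ⟨v, l'', ⟨h₂, ρ'', hv, hw'⟩ | ⟨h₂, hv, hw'⟩⟩ := h₂ s l'
  · exact ⟨v, l'', .inl ⟨h₁.trans h₂, ρ'', hv, hw'.trans hw⟩⟩
  · exact ⟨v, l'', .inr ⟨h₁.trans h₂, hv, hw'.trans hw⟩⟩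

/-- Closure under anti-reduction, in a form that lets the freelist change as long as the total
weight is kept. At negative types the extra frame is pushed on the stack and the type decreases. -/
theorem Comp.of_steps {c : Stack → List ℕ → Cmd}
    (h : ∀ s l, ∃ l' ρ' c', Steps (c s l) (c' s l') ∧ ρ' * weight φ l' = ρ * weight φ l ∧
      Comp φ E A ρ' c') : Comp φ E A ρ c := by
  induction A generalizing ρ c with
  | lolly A B _ ih =>
    intro σ v hv
    refine ih fun s l => ?_
    obtain ⟨l', ρ', c', h₁, hw, h₂⟩ := h (.arg (B.polNeg E) v s) l
    -- The argument stands on the left, so its weight `σ` merely multiplies the conservation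
    -- equation from the left.
    exact ⟨l', σ * ρ', _, h₁, by rw [mul_assoc, hw, mul_assoc], h₂ σ v hv⟩
  | amp A B ih₁ ih₂ =>
    refine ⟨ih₁ fun s l => ?_, ih₂ fun s l => ?_⟩
    · obtain ⟨l', ρ', c', h₁, hw, h₂⟩ := h (.fst (A.polNeg E) s) l
      exact ⟨l', ρ', _, h₁, hw, h₂.1⟩
    · obtain ⟨l', ρ', c', h₁, hw, h₂⟩ := h (.snd (B.polNeg E) s) l
      exact ⟨l', ρ', _, h₁, hw, h₂.2⟩
  | _ => exact Returns.of_steps h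

theorem Comp.head {c c' : Stack → List ℕ → Cmd} (h : ∀ s l, Steps (c s l) (c' s l))
    (hc : Comp φ E A ρ c') : Comp φ E A ρ c :=
  .of_steps fun s l => ⟨l, ρ, c', h s l, rfl, hc⟩

theorem DropsTo.head {t t' : Tm} (h : ∀ s l, Steps ⟨t, s, l, .pos⟩ ⟨t', s, l, .pos⟩)
    (ht : DropsTo φ t' ρ) : DropsTo φ t ρ :=
  .of_steps fun s l => ⟨l, ρ, t', h s l, rfl, ht⟩

theorem Expr.of_steps {v : Tm} (h : ∀ s l, ∃ l' ρ' v',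
    Steps ⟨v, s, l, .neg⟩ ⟨v', s, l', .neg⟩ ∧ ρ' * weight φ l' = ρ * weight φ l ∧
      Expr φ E A ρ' v') : Expr φ E A ρ v := by
  refine ⟨.of_steps fun s l => ?_, fun s l => ?_⟩
  · obtain ⟨l', ρ', v', h₁, hw, h₂⟩ := h (.fst _ s) l
    exact ⟨l', ρ', _, h₁, hw, h₂.1⟩
  · obtain ⟨l', ρ', v', h₁, hw, h₂⟩ := h (.snd .pos s) l
    obtain ⟨l'', h₂, hw'⟩ := h₂.2 s l'
    -- The run for `v'` starts at `snd v'`. Its first step can only be the one that pushes the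
    -- projection; removing it leaves a run that continues the one from `v`.
    rcases h₂.cases_head with h₂ | ⟨d, hd, h₂⟩
    · cases h₂
    · cases hd with
      | snd => exact ⟨l'', .head (.snd _ _ _ _) (h₁.trans h₂), hw'.trans hw⟩
      | ret _ _ _ _ _ hv => cases hv

theorem Expr.head {v v' : Tm} (h : ∀ s l, Step ⟨v, s, l, .neg⟩ ⟨v', s, l, .neg⟩)
    (hv : Expr φ E A ρ v') : Expr φ E A ρ v :=
  .of_steps fun s l => ⟨l, ρ, v', .single (h s l), rfl, hv⟩

theorem Expr.ampPair {t u : Tm} (ht : Comp φ E A ρ fun s l => ⟨t, s, l, A.polNeg E⟩)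
    (hu : DropsTo φ u ρ) : Expr φ E A ρ (.ampPair t u) :=
  ⟨.head (fun _ _ => .single (.ampFst _ _ _ _ _)) ht,
    .head (fun _ _ => .head (.snd _ _ _ _) (.single (.ampSnd _ _ _ _ _))) hu⟩

theorem dropsTo_unit : DropsTo φ .unit 1 := fun _ l => ⟨l, .refl, (one_mul _).symm⟩

theorem Expr.comp_fst {v : Tm} (h : Expr φ E A ρ v) :
    Comp φ E A ρ fun s l => ⟨.fst (A.polNeg E) v, s, l, A.polNeg E⟩ :=
  .head (fun _ _ => .single (.fst _ _ _ _)) h.1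

/-- The computation of a negative value. -/
theorem Val.comp_fst (hA : A.pol = .neg) {v : Tm} (h : Val φ E A ρ v) :
    Comp φ E A ρ fun s l => ⟨.fst .neg v, s, l, .neg⟩ := by
  have := ((val_of_neg hA).1 h).2.comp_fst
  rwa [polNeg_eq, hA] at this

/-! #### Destructors -/

theorem DropsTo.seq_steps {t : Tm} (ht : DropsTo φ t ρ) (u : Tm) (s : Stack) (l : List ℕ) :
    ∃ l', Steps ⟨t.seq u, s, l, .pos⟩ ⟨u, s, l', .pos⟩ ∧ weight φ l' = ρ * weight φ l := by
  obtain ⟨l', h, hw⟩ :=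
    ht (.cont .pos (.caseUnit .pos (.var 0) (u.rename Nat.succ)) s) l
  exact ⟨l', .head (.letPos _ _ _ _ _) (h.trans (Steps.ret_caseUnit _ _ _)), hw⟩

/-- The order of weights is opposite to that of evaluation: what is dropped first is nearest to the
freelist, hence the right factor. -/
theorem DropsTo.seq {t u : Tm} {ρ₁ ρ₂ : M} (ht : DropsTo φ t ρ₂) (hu : DropsTo φ u ρ₁) :
    DropsTo φ (t.seq u) (ρ₁ * ρ₂) :=
  .of_steps fun s l =>
    let ⟨l', h, hw⟩ := ht.seq_steps u s l
    ⟨l', ρ₁, u, h, by rw [hw, mul_assoc], hu⟩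

/-- The destructor of a tensor drops the right component first, so pushing on the freelist restores
the left-to-right order. At negative types the claim is the second half of the lazy pair. -/
theorem Val.dropsTo {v : Tm} (h : Val φ E A ρ v) : DropsTo φ (.app .pos (dropTy A) v) ρ := by
  induction A generalizing ρ v with
  | res =>
    obtain ⟨n, rfl, rfl⟩ := h
    exact fun s l => ⟨n :: l, (Steps.app_lam _ _ _ _ _).trans
      (.head (.app _ _ _ _ _) (.single (.delete _ _ _ _))), weight_cons _ _ _⟩
  | one =>
    obtain ⟨rfl, rfl⟩ := h
    exact fun s l => ⟨l, Steps.app_lam _ _ _ _ _, (one_mul _).symm⟩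
  | tensor A B ih₁ ih₂ =>
    obtain ⟨ρ₁, ρ₂, a, b, ha, hb, rfl, rfl⟩ := h
    refine .head (fun s l => (Steps.app_lam _ _ _ _ _).trans
      (.single (.casePair_subst _ _ _ rfl))) ?_
    rw [Tm.seq_subst]
    simp only [Tm.subst, dropTy_subst]
    exact (ih₂ hb).seq (ih₁ ha)
  | plus A B ih₁ ih₂ =>
    rcases h with ⟨a, rfl, ha⟩ | ⟨a, rfl, ha⟩
    · refine .head (fun s l => (Steps.app_lam _ _ _ _ _).trans
        (.single (.caseInl_subst _ _ _ _ rfl))) ?_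
      simp only [Tm.subst, dropTy_subst]
      exact ih₁ ha
    · refine .head (fun s l => (Steps.app_lam _ _ _ _ _).trans
        (.single (.caseInr_subst _ _ _ _ rfl))) ?_
      simp only [Tm.subst, dropTy_subst]
      exact ih₂ ha
  | lolly => exact .head (fun s l => Steps.app_lam _ _ _ _ _) h.2.2
  | amp => exact .head (fun s l => Steps.app_lam _ _ _ _ _) h.2.2

/-! #### Environments -/

theorem env_append {Γ Δ : Ctx} {γ : ℕ → Tm} :
    Env φ E (Γ ++ Δ) ρ γ ↔ ∃ ρ₁ ρ₂, Env φ E Γ ρ₁ γ ∧ Env φ E Δ ρ₂ γ ∧ ρ = ρ₁ * ρ₂ := by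
  induction Γ generalizing ρ with
  | nil =>
    constructor
    · exact fun h => ⟨1, ρ, rfl, h, (one_mul ρ).symm⟩
    · rintro ⟨_, _, rfl, h, rfl⟩
      rwa [one_mul]
  | cons p Γ ih =>
    constructor
    · rintro ⟨ρ₁, _, h₁, h, rfl⟩
      obtain ⟨ρ₂, ρ₃, h₂, h₃, rfl⟩ := ih.1 h
      exact ⟨_, ρ₃, ⟨ρ₁, ρ₂, h₁, h₂, rfl⟩, h₃, (mul_assoc _ _ _).symm⟩
    · rintro ⟨_, ρ₃, ⟨ρ₁, ρ₂, h₁, h₂, rfl⟩, h₃, rfl⟩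
      exact ⟨ρ₁, _, h₁, ih.2 ⟨ρ₂, ρ₃, h₂, h₃, rfl⟩, mul_assoc _ _ _⟩

theorem env_singleton {x : ℕ} {γ : ℕ → Tm} :
    Env φ E [(x, A)] ρ γ ↔ Val φ E A ρ (γ x) := by
  constructor
  · rintro ⟨ρ₁, _, h, rfl, rfl⟩
    rwa [mul_one]
  · exact fun h => ⟨ρ, 1, h, rfl, (mul_one ρ).symm⟩

theorem env_up {Γ : Ctx} {k : ℕ} {γ : ℕ → Tm} :
    Env φ E (Γ.up k) ρ γ ↔ Env φ E Γ ρ fun i => γ (i + k) := by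
  induction Γ generalizing ρ with
  | nil => rfl
  | cons p Γ ih => exact exists_congr fun _ => exists_congr fun _ =>
      and_congr_right fun _ => and_congr_left fun _ => ih

theorem Env.dropsTo {Γ : Ctx} {γ : ℕ → Tm} (h : Env φ E Γ ρ γ) :
    DropsTo φ ((dropCtx Γ).subst γ) ρ := by
  -- Induction from the right end of the context, the end that is dropped first.
  obtain ⟨L, rfl⟩ := List.reverse_surjective Γ
  rw [dropCtx, List.reverse_reverse]
  induction L generalizing ρ with
  | nil => cases h; exact dropsTo_unit
  | cons p L ih =>
    rw [List.reverse_cons, env_append] at h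
    obtain ⟨ρ₁, ρ₂, h₁, h₂, rfl⟩ := h
    rw [dropCtxRev, Tm.seq_subst]
    simp only [Tm.subst, dropTy_subst]
    exact (env_singleton.1 h₂).dropsTo.seq (ih h₁)

/-! #### Raising exceptions -/

/-- The exception is swapped past the rightmost variable, which then becomes adjacent to the
freelist and can be dropped. The statement is general in the number `k` of binders crossed and in
the index `e` because both change at each round. -/
theorem Env.unwindRev_steps {w : Tm} (hw : CentralVal E w) {L : Ctx} :
    ∀ {ρ : M} {γ : ℕ → Tm} {k e : ℕ}, (Env φ E L.reverse ρ fun i => γ (i + k)) → γ e = w →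
    ∀ s l, ∃ l', Steps ⟨(unwindRev E L k e).subst γ, s, l, .pos⟩ ⟨w, s, l', .pos⟩ ∧
      weight φ l' = ρ * weight φ l := by
  induction L with
  | nil =>
    rintro ρ γ k e h rfl s l
    cases h
    exact ⟨l, .refl, (one_mul _).symm⟩
  | cons p L ih =>
    obtain ⟨x, A⟩ := p
    intro ρ γ k e h he s l
    rw [List.reverse_cons, env_append] at h
    obtain ⟨ρ₁, ρ₂, h₁, h₂, rfl⟩ := h
    have hx : Val φ E A ρ₂ (γ (x + k)) := env_singleton.1 h₂
    set v := γ (x + k) with hv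
    -- The three binders of one round: index 0 is the variable to drop, 1 the exception, 2 the
    -- swapped pair. Hence `k + 3` and `1` in the recursive call.
    let γ' := scons v (scons w (scons (.pair w v) γ))
    obtain ⟨l₁, h₃, hl₁⟩ := hx.dropsTo.seq_steps ((unwindRev E L (k + 3) 1).subst γ') s l
    obtain ⟨l₂, h₄, hl₂⟩ := ih (γ := γ') (k := k + 3) (e := 1) h₁ rfl s l₁
    refine ⟨l₂, .head (.letPos_subst _ _ _ _ _ _) ?_, by rw [hl₂, hl₁, mul_assoc]⟩
    simp only [Tm.subst.eq_15, swap_subst, Tm.subst.eq_4, Tm.subst.eq_1, ← hv, he]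
    refine (swap_steps E v w hx.isVal hw _ _).trans
      (.head (.ret_subst _ (hw.isVal.pair hx.isVal) _ _ _ _)
        (.head (.casePair_subst _ _ _ rfl) ?_))
    rw [Tm.seq_subst]
    simp only [Tm.subst.eq_15, dropTy_subst]
    exact h₃.trans h₄

theorem Env.returns_unwind {Γ : Ctx} {γ : ℕ → Tm} {e : ℕ} (h : Env φ E Γ ρ γ)
    (he : CentralVal E (γ e)) (V : M → Tm → Prop) :
    Returns φ E V ρ fun s l =>
      ⟨(Tm.letin .pos .pos (unwind E Γ e) (.inr (.var 0))).subst γ, s, l, .pos⟩ := by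
  intro s l
  rw [← Γ.reverse_reverse] at h
  obtain ⟨l', h₁, hl⟩ := h.unwindRev_steps (k := 0) he rfl
    (.cont .pos ((Tm.inr (.var 0)).subst (liftSub γ)) s) l
  exact ⟨γ e, l', .inr ⟨.head (.letPos_subst _ _ _ _ _ _)
    (h₁.trans (.single (.ret_subst _ he.isVal _ _ _ _))), he, hl⟩⟩

/-- At negative types the raised term waits for its arguments and projections, adding each argument
on the left of the context, as the model of functions requires. At a positive type everything
collected is unwound. -/
theorem Env.comp_raise (A : Ty) {Γ : Ctx} {γ : ℕ → Tm} {e : ℕ} (h : Env φ E Γ ρ γ)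
    (he : CentralVal E (γ e)) :
    Comp φ E A ρ fun s l => ⟨(raiseTm E A Γ e).subst γ, s, l, A.polNeg E⟩ := by
  induction A generalizing Γ ρ γ e with
  | lolly B C _ ih =>
    intro σ v hv
    refine Comp.head (fun s l => .single (.lam_subst _ _ _ _ _ _)) (ih ?_ he)
    exact ⟨σ, ρ, hv, env_up.2 h, rfl⟩
  | amp B C ih₁ ih₂ =>
    exact ⟨Comp.head (fun s l => .single (.ampFst _ _ _ _ _)) (ih₁ h he),
      Comp.head (fun s l => .single (.ampSnd _ _ _ _ _)) (ih₂ h he)⟩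
  | _ => exact h.returns_unwind he _

end Semantics

/-! ### The fundamental lemma -/

theorem tr_isVal {E : CentralTy} (newFail : Tm) {k : Kind} {Γ : Ctx} {A : Ty}
    (d : Der E k Γ A) : (tr newFail d).IsVal := by
  induction d with
  | _ => simp_all [tr, Tm.IsVal, Tm.IsVal.rename]

section Fundamental

variable {M : Type*} [Monoid M] {φ : ℕ → M} {E : CentralTy} {A B : Ty} {ρ : M}

variable (φ) in
/-- The interpretation of the two kinds of judgements. -/
def Interp (E : CentralTy) : Kind → Ty → M → Tm → Prop
  | .val => Val φ E
  | .exp => Expr φ E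

/-! ### Compatibility of the model with binding and with the constants -/

theorem Expr.letin {t u : Tm} {γ : ℕ → Tm} (ht : Val φ E A ρ (t.subst γ))
    {ρ' : M} (hu : Expr φ E B ρ' (u.subst (scons (t.subst γ) γ))) :
    Expr φ E B ρ' ((Tm.letin (A.polPos E) .neg t u).subst γ) := by
  refine .of_steps fun s l => ⟨l, ρ', _, ?_, rfl, hu⟩
  rw [polPos_eq]
  cases A.pol with
  | pos => exact .head (.letPos_subst _ _ _ _ _ _) (.single (.ret_subst _ ht.isVal _ _ _ _))
  | neg => exact .single (.letNeg_subst _ _ _ _ _ _)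

/-- Common core of `let` and `try`. While `t` runs, `ρ₁` is a left frame. If `t` raises, it has
already released all of `ρ₂`, so the handler owns `ρ₁` alone. -/
theorem Expr.letin_caseSum {t u₁ u₂ : Tm} {γ : ℕ → Tm} {ρ₁ ρ₂ : M} (hA : A.pol = .pos)
    (ht : Expr φ E A ρ₂ (t.subst γ))
    (h₁ : ∀ ρ' v, Val φ E A ρ' v →
      Expr φ E B (ρ₁ * ρ') (u₁.subst (scons v (scons (.inl v) γ))))
    (h₂ : ∀ v, CentralVal E v → Expr φ E B ρ₁ (u₂.subst (scons v (scons (.inr v) γ)))) :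
    Expr φ E B (ρ₁ * ρ₂)
      ((Tm.letin .pos .neg (.fst .pos t) (.caseSum .neg (.var 0) u₁ u₂)).subst γ) := by
  have hr := ht.comp_fst
  rw [polNeg_eq, hA, comp_of_pos hA] at hr
  refine .of_steps fun s l => ?_
  obtain ⟨v, l', ⟨hs, ρ', hv, hw⟩ | ⟨hs, hv, hw⟩⟩ :=
    hr (.cont .neg ((Tm.caseSum .neg (.var 0) u₁ u₂).subst (liftSub γ)) s) l
  · exact ⟨l', ρ₁ * ρ', _, .head (.letPos_subst _ _ _ _ _ _) (hs.trans
      (.head (.ret_subst _ (v := .inl v) hv.isVal _ _ _ _)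
        (.single (.caseInl_subst _ _ _ _ rfl)))),
      by rw [mul_assoc, hw, mul_assoc], h₁ ρ' v hv⟩
  · exact ⟨l', ρ₁, _, .head (.letPos_subst _ _ _ _ _ _) (hs.trans
      (.head (.ret_subst _ (v := .inr v) hv.isVal _ _ _ _)
        (.single (.caseInr_subst _ _ _ _ rfl)))),
      by rw [hw, mul_assoc], h₂ v hv⟩

theorem val_drop (A : Ty) (γ : ℕ → Tm) :
    Val φ E (.lolly A .one) 1 ((tr (E := E) newFail (.drop A)).subst γ) := by
  refine ⟨trivial, Expr.ampPair (A := .lolly A .one) (fun σ v hv s l => ?_) dropsTo_unit⟩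
  obtain ⟨l', hs, hw⟩ := Val.dropsTo hv (.cont .pos (.inl (.var 0)) s) l
  refine ⟨.unit, l', .inl ⟨.head (.lam_subst _ _ _ _ _ _)
    (.head (.letPos_subst _ _ _ _ _ _) ?_), 1, ⟨rfl, rfl⟩, by rw [hw, one_mul, mul_one]⟩⟩
  simp only [Tm.subst.eq_15, dropTy_subst]
  exact hs.trans (.single (.ret _ .unit _ _ _ trivial))

/-- On a nonempty freelist the factor `φ n` passes from the freelist to the returned value, and the
product is the same. On the empty one `newFail` is raised, of weight 1. -/
theorem val_new {newFail : Tm} (hclosed : ∀ σ, newFail.subst σ = newFail)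
    (hfail : CentralVal E newFail) (γ : ℕ → Tm) :
    Val φ E (.lolly .one .res) 1 ((tr (E := E) newFail .new).subst γ) := by
  refine ⟨trivial, Expr.ampPair (A := .lolly .one .res) ?_ dropsTo_unit⟩
  rintro _ _ ⟨rfl, rfl⟩ s l
  cases l with
  | nil =>
    refine ⟨newFail, [], .inr ⟨.head (.lam_subst _ _ _ _ _ _) (.head (.caseUnit_subst _ _ _ rfl)
      (.head (.letPos_subst _ _ _ _ _ _) (.head (.app _ _ _ _ _) (.head (.newNone _ _)
      (.head (.ret_subst _ (v := .inr .unit) trivial _ _ _ _)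
      (.head (.caseInr_subst _ _ _ _ rfl) ?_)))))), hfail, by simp⟩⟩
    rw [Tm.seq_subst]
    simp only [Tm.subst, hclosed]
    exact .head (.letPos _ _ _ _ _) (Steps.ret_caseUnit _ _ _)
  | cons n l =>
    exact ⟨.res n, l, .inl ⟨.head (.lam_subst _ _ _ _ _ _) (.head (.caseUnit_subst _ _ _ rfl)
      (.head (.letPos_subst _ _ _ _ _ _) (.head (.app _ _ _ _ _) (.head (.newSome _ _ _ _)
      (.head (.ret_subst _ (v := .inl (.res n)) trivial _ _ _ _)
      (.single (.caseInl_subst _ _ _ _ rfl))))))), φ n, ⟨n, rfl, rfl⟩,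
      by rw [weight_cons]; simp⟩⟩

theorem val_raise (newFail : Tm) (A : Ty) (γ : ℕ → Tm) :
    Val φ E (.lolly E.toTy A) 1 ((tr (E := E) newFail (.raise A)).subst γ) := by
  refine ⟨trivial, Expr.ampPair (A := .lolly E.toTy A) (fun σ v hv => ?_) dropsTo_unit⟩
  obtain ⟨hv', rfl⟩ := val_toTy.1 hv
  rw [mul_one]
  exact Comp.head (fun s l => .single (.lam_subst _ _ _ _ _ _))
    (Env.comp_raise (Γ := []) (ρ := 1) (e := 0) A rfl hv')

/-- Each rule splits the weight of the environment as it splits the context. The disjunction in `hd`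
serves both halves of the theorem with a single induction. Every index of `γ` must be a value so
that substituted negative expressions remain values. -/
theorem interp_tr {newFail : Tm} (hclosed : ∀ σ, newFail.subst σ = newFail)
    (hfail : CentralVal E newFail) {k : Kind} {Γ : Ctx} {A : Ty} (d : Der E k Γ A)
    (hd : d.MoveFree ∨ ∀ a b : M, a * b = b * a) :
    ∀ {ρ : M} {γ : ℕ → Tm}, (∀ i, (γ i).IsVal) → Env φ E Γ ρ γ →
      Interp φ E k A ρ ((tr newFail d).subst γ) := by
  induction d with
  | var x A => exact fun _ h => env_singleton.1 h
  | unit => exact fun _ h => ⟨rfl, h⟩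
  | pair v w ihv ihw =>
    intro ρ γ hγ h
    obtain ⟨ρ₁, ρ₂, h₁, h₂, rfl⟩ := env_append.1 h
    exact ⟨ρ₁, ρ₂, _, _, ihv (hd.imp_left And.left) hγ h₁, ihw (hd.imp_left And.right) hγ h₂,
      rfl, rfl⟩
  | inl v ih => exact fun hγ h => .inl ⟨_, rfl, ih hd hγ h⟩
  | inr v ih => exact fun hγ h => .inr ⟨_, rfl, ih hd hγ h⟩
  | @lam Γ A B t ih =>
    intro ρ γ hγ h
    refine ⟨trivial, Expr.ampPair (A := .lolly A B) (fun σ v hv => ?_) h.dropsTo⟩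
    have ht : Expr φ E B (σ * ρ) ((tr newFail t).subst (scons v γ)) :=
      ih hd (scons_isVal (Val.isVal hv) hγ) ⟨σ, ρ, hv, env_up.2 h, rfl⟩
    exact Comp.head (fun s l => .single (.lam_subst _ _ _ _ _ _)) ht.comp_fst
  | @ampPair Γ A B t u iht ihu =>
    intro ρ γ hγ h
    have ht : Expr φ E A ρ ((tr newFail t).subst γ) := iht (hd.imp_left And.left) hγ h
    have hu : Expr φ E B ρ ((tr newFail u).subst γ) := ihu (hd.imp_left And.right) hγ h
    exact ⟨trivial, Expr.ampPair (A := .amp A B)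
      ⟨Comp.head (fun s l => .single (.ampFst _ _ _ _ _)) ht.comp_fst,
        Comp.head (fun s l => .single (.ampSnd _ _ _ _ _)) hu.comp_fst⟩ h.dropsTo⟩
  | drop A =>
    intro ρ γ _ h
    cases h
    exact val_drop A γ
  | new =>
    intro ρ γ _ h
    cases h
    exact val_new hclosed hfail γ
  | raise A =>
    intro ρ γ _ h
    cases h
    exact val_raise newFail A γ
  | negVal hA t ih =>
    exact fun hγ h => (val_of_neg hA).2 ⟨(tr_isVal newFail t).subst hγ, ih hd hγ h⟩
  | negExp hA v ih => exact fun hγ h => ((val_of_neg hA).1 (ih hd hγ h)).2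
  | @coerc Γ A hA v ih =>
    intro ρ γ hγ h
    refine Expr.ampPair ?_ h.dropsTo
    rw [comp_of_pos hA, polNeg_eq, hA]
    exact fun s l => ⟨_, l, .inl ⟨.refl, ρ, ih hd hγ h, rfl⟩⟩
  | move t ih =>
    intro ρ γ hγ h
    -- `MoveFree` is `False` on `move`, so commutativity is available. It is used only here, to
    -- exchange the weights `σ` and `τ`.
    have hc := hd.resolve_left id
    obtain ⟨_, ρ₃, h', h₃, rfl⟩ := env_append.1 h
    obtain ⟨ρ₁, _, h₁, ⟨σ, _, hy, ⟨τ, _, hx, rfl, rfl⟩, rfl⟩, rfl⟩ := env_append.1 h'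
    refine ih (.inr hc) hγ (env_append.2 ⟨_, ρ₃, env_append.2 ⟨ρ₁, _, h₁,
      ⟨τ, _, hx, ⟨σ, 1, hy, rfl, rfl⟩, rfl⟩, rfl⟩, h₃, ?_⟩)
    rw [mul_one, mul_one, hc σ τ]
  | @letVal Γ Δ A B v u ihv ihu =>
    intro ρ γ hγ h
    obtain ⟨ρ₁, ρ₂, h₁, h₂, rfl⟩ := env_append.1 h
    have hv : Val φ E A ρ₂ ((tr newFail v).subst γ) := ihv (hd.imp_left And.left) hγ h₂
    exact Expr.letin hv (ihu (hd.imp_left And.right) (scons_isVal hv.isVal hγ)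
      (env_append.2 ⟨ρ₁, ρ₂, env_up.2 h₁, env_singleton.2 hv, rfl⟩))
  | @letExp Γ Δ A B hA t u iht ihu =>
    intro ρ γ hγ h
    obtain ⟨ρ₁, ρ₂, h₁, h₂, rfl⟩ := env_append.1 h
    refine Expr.letin_caseSum hA (iht (hd.imp_left And.left) hγ h₂)
      (fun ρ' v hv => ?_) fun v hv => ?_
    -- The renaming skips the index of the scrutinee `s`, so the environment seen by `u` is `γ`
    -- extended by `v` alone.
    · rw [Tm.subst_of_rename]
      refine ihu (hd.imp_left And.right) ?_
        (env_append.2 ⟨ρ₁, ρ', env_up.2 h₁, env_singleton.2 hv, rfl⟩)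
      rintro (_ | i)
      · exact hv.isVal
      · exact hγ i
    · have h₁' : Env φ E (Γ.up 2) ρ₁ (scons v (scons (.inr v) γ)) := env_up.2 h₁
      exact Expr.ampPair (h₁'.comp_raise B hv) (Env.dropsTo (env_append.2
        ⟨ρ₁, 1, h₁', env_singleton.2 (val_toTy.2 ⟨hv, rfl⟩), (mul_one _).symm⟩))
  | @tryIn Γ Δ A B hA t u u' iht ihu ihu' =>
    intro ρ γ hγ h
    obtain ⟨ρ₁, ρ₂, h₁, h₂, rfl⟩ := env_append.1 h
    refine Expr.letin_caseSum hA (iht (hd.imp_left And.left) hγ h₂)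
      (fun ρ' v hv => ?_) fun v hv => ?_
    · rw [Tm.subst_of_rename]
      refine ihu (hd.imp_left fun h => h.2.1) ?_
        (env_append.2 ⟨ρ₁, ρ', env_up.2 h₁, env_singleton.2 hv, rfl⟩)
      rintro (_ | i)
      · exact hv.isVal
      · exact hγ i
    · rw [Tm.subst_of_rename]
      refine ihu' (hd.imp_left fun h => h.2.2) ?_ (env_append.2
        ⟨ρ₁, 1, env_up.2 h₁, env_singleton.2 (val_toTy.2 ⟨hv, rfl⟩), (mul_one _).symm⟩)
      rintro (_ | i)
      · exact hv.isVal
      · exact hγ i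
  | @casePair Γ Δ Γ' A B C v t ihv iht =>
    intro ρ γ hγ h
    obtain ⟨_, ρ₃, h', h₃, rfl⟩ := env_append.1 h
    obtain ⟨ρ₁, ρ₂, h₁, h₂, rfl⟩ := env_append.1 h'
    obtain ⟨σ, τ, a, b, ha, hb, hv, rfl⟩ := ihv (hd.imp_left And.left) hγ h₂
    refine Expr.head (fun s l => .casePair_subst _ _ _ hv) ?_
    exact iht (hd.imp_left And.right) (scons_isVal (Val.isVal hb) (scons_isVal (Val.isVal ha) hγ))
      (env_append.2 ⟨_, ρ₃, env_append.2 ⟨ρ₁, _, env_up.2 h₁,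
        ⟨σ, τ, ha, env_singleton.2 hb, rfl⟩, rfl⟩, env_up.2 h₃, rfl⟩)
  | @caseUnit Γ Δ Γ' C v t ihv iht =>
    intro ρ γ hγ h
    obtain ⟨_, ρ₃, h', h₃, rfl⟩ := env_append.1 h
    obtain ⟨ρ₁, ρ₂, h₁, h₂, rfl⟩ := env_append.1 h'
    obtain ⟨hv, rfl⟩ := ihv (hd.imp_left And.left) hγ h₂
    refine Expr.head (fun s l => .caseUnit_subst _ _ _ hv) ?_
    exact iht (hd.imp_left And.right) hγ (env_append.2 ⟨ρ₁, ρ₃, h₁, h₃, by rw [mul_one]⟩)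
  | @caseSum Γ Δ Γ' A B C v t u ihv iht ihu =>
    intro ρ γ hγ h
    obtain ⟨_, ρ₃, h', h₃, rfl⟩ := env_append.1 h
    obtain ⟨ρ₁, ρ₂, h₁, h₂, rfl⟩ := env_append.1 h'
    obtain ⟨a, hv, ha⟩ | ⟨a, hv, ha⟩ := ihv (hd.imp_left And.left) hγ h₂
    · refine Expr.head (fun s l => .caseInl_subst _ _ _ _ hv) ?_
      exact iht (hd.imp_left fun h => h.2.1) (scons_isVal (Val.isVal ha) hγ)
        (env_append.2 ⟨_, ρ₃, env_append.2 ⟨ρ₁, ρ₂, env_up.2 h₁, env_singleton.2 ha, rfl⟩,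
          env_up.2 h₃, rfl⟩)
    · refine Expr.head (fun s l => .caseInr_subst _ _ _ _ hv) ?_
      exact ihu (hd.imp_left fun h => h.2.2) (scons_isVal (Val.isVal ha) hγ)
        (env_append.2 ⟨_, ρ₃, env_append.2 ⟨ρ₁, ρ₂, env_up.2 h₁, env_singleton.2 ha, rfl⟩,
          env_up.2 h₃, rfl⟩)
  | @app Γ Δ A B w v ihw ihv =>
    intro ρ γ hγ h
    refine Expr.ampPair ?_ h.dropsTo
    obtain ⟨ρ₁, ρ₂, h₁, h₂, rfl⟩ := env_append.1 h
    have hv : Val φ E (.lolly A B) ρ₂ ((tr newFail v).subst γ) :=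
      ihv (hd.imp_left And.right) hγ h₂
    exact Comp.head (fun s l => .single (.app _ _ _ _ _))
      (hv.comp_fst rfl ρ₁ _ (ihw (hd.imp_left And.left) hγ h₁))
  | @fst Γ A B v ih =>
    intro ρ γ hγ h
    have hv : Val φ E (.amp A B) ρ ((tr newFail v).subst γ) := ih hd hγ h
    exact Expr.ampPair (Comp.head (fun s l => .single (.fst _ _ _ _)) (hv.comp_fst rfl).1)
      h.dropsTo
  | @snd Γ A B v ih =>
    intro ρ γ hγ h
    have hv : Val φ E (.amp A B) ρ ((tr newFail v).subst γ) := ih hd hγ h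
    exact Expr.ampPair (Comp.head (fun s l => .single (.snd _ _ _ _)) (hv.comp_fst rfl).2)
      h.dropsTo

/-- A closed expression of central type preserves the weight of the freelist. -/
theorem weight_eq_of_steps (φ : ℕ → M) {newFail : Tm} (hval : newFail.IsVal)
    (htyped : Typed [] newFail E.toTy) {W : CentralTy} (t : Der E .exp [] W.toTy)
    (ht : t.MoveFree ∨ ∀ a b : M, a * b = b * a) {v : Tm} {l l' : List ℕ} (hv : v.IsVal)
    (h : Steps ⟨.fst .pos (tr newFail t), .nil, l, .pos⟩ ⟨v, .nil, l', .pos⟩) :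
    weight φ l' = weight φ l := by
  have hW : W.toTy.pol = .pos := by cases W <;> rfl
  -- A closed term is run in the identity environment, which interprets the empty context with
  -- weight 1.
  have hr : Expr φ E W.toTy 1 ((tr newFail t).subst .var) :=
    interp_tr (fun σ => htyped.subst_eq σ fixes_nil) (htyped.centralVal hval rfl E rfl) t ht
      (fun _ => trivial) rfl
  have hr := hr.comp_fst
  rw [polNeg_eq, hW, comp_of_pos hW, Tm.subst_var] at hr
  -- The model yields one terminating run, and the given run has the same result. A normal result is
  -- central, so its weight is 1; an exceptional one contributes no weight.
  obtain ⟨w, m, ⟨hs, ρ', hw, he⟩ | ⟨hs, hw, he⟩⟩ := hr .nil l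
  · obtain ⟨-, rfl⟩ := h.result_unique hv (w := .inl w) hw.isVal hs
    obtain ⟨-, rfl⟩ := val_toTy.1 hw
    simpa using he
  · obtain ⟨-, rfl⟩ := h.result_unique hv (w := .inr w) hw.isVal hs
    simpa using he

end Fundamental

/-! ### Weights in the free monoid and in the free commutative monoid -/

theorem weight_of (l : List ℕ) : weight FreeMonoid.of l = FreeMonoid.ofList l := by
  induction l with
  | nil => rfl
  | cons n l ih => rw [weight_cons, ih]; rfl

theorem weight_singleton (l : List ℕ) :
    weight (fun n => Multiplicative.ofAdd ({n} : Multiset ℕ)) l = Multiplicative.ofAdd ↑l := by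
  induction l with
  | nil => rfl
  | cons n l ih => rw [weight_cons, ih]; rfl

end ResourceCalc

theorem mainTheorem3 (E : ResourceCalc.CentralTy) (newFail : ResourceCalc.Tm)
    (hval : newFail.IsVal) (htyped : ResourceCalc.Typed [] newFail E.toTy)
    (W : ResourceCalc.CentralTy)
    (t : ResourceCalc.Der E ResourceCalc.Kind.exp [] W.toTy) :
    (∀ (v : ResourceCalc.Tm) (l l' : List ℕ), v.IsVal →
      ResourceCalc.Steps
        ⟨.fst .pos (ResourceCalc.tr newFail t), .nil, l, .pos⟩ ⟨v, .nil, l', .pos⟩ →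
      l'.Perm l) ∧
    (t.MoveFree →
      ∀ (v : ResourceCalc.Tm) (l l' : List ℕ), v.IsVal →
        ResourceCalc.Steps
          ⟨.fst .pos (ResourceCalc.tr newFail t), .nil, l, .pos⟩ ⟨v, .nil, l', .pos⟩ →
        l' = l) := by
  refine ⟨fun v l l' hv h => ?_, fun ht v l l' hv h => ?_⟩
  -- Multisets, written multiplicatively, form a commutative monoid: `move` is allowed, and equality
  -- of weights means permutation.
  · have := ResourceCalc.weight_eq_of_steps
      (fun n => Multiplicative.ofAdd ({n} : Multiset ℕ)) hval htyped t (.inr mul_comm) hv h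
    rw [ResourceCalc.weight_singleton, ResourceCalc.weight_singleton] at this
    exact Multiset.coe_eq_coe.1 (Multiplicative.ofAdd.injective this)
  -- The free monoid remembers the order, so equality of weights is equality of freelists. It is not
  -- commutative, which is why `move` must be absent.
  · have := ResourceCalc.weight_eq_of_steps FreeMonoid.of hval htyped t (.inl ht) hv h
    rw [ResourceCalc.weight_of, ResourceCalc.weight_of] at this
    exact FreeMonoid.ofList.injective this
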